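/- **Setting.** Let $\overline{\mathbb{G}}$ be a connected, locally finite simple graph with a distinguished vertex $0$, graph distance $d$ and closed balls $\mathbb{B}(x,\rho)$. Fix a (deterministic) subgraph $\mathbb{G}_0$ of $\overline{\mathbb{G}}$ that contains all vertices of $\overline{\mathbb{G}}$ and all edges of $\overline{\mathbb{G}}$ at $0$. For a subgraph $\mathbb{G}$ of $\overline{\mathbb{G}}$ with the same vertex set, put $\partial\mathbb{G}=\{z:\deg_{\mathbb{G}}(z)<\deg_{\overline{\mathbb{G}}}(z)\}$. Fix $c<1$ and a function $r$ on the vertices with $1\le r(x)\le\max(1,c\,d(x,0))$ for all $x$, and put $\mathcal{C}(x)=\mathbb{B}(x,r(x))$. Write $\mathbb{P}_y$ for the law of simple random walk (SRW) on $\overline{\mathbb{G}}$ started at $y$. On a probability space with a filtration $(\mathcal{F}_t)_{t\ge0}$ consider adapted sequences of vertices $Y_t$, with $Y_0=0$, and of subgraphs $\mathbb{G}_t$ of $\overline{\mathbb{G}}$, starting at $\mathbb{G}_0$ and non-decreasing in $t$, such that $\mathbb{G}_{t+1}=\mathbb{G}_t$ if $Y_t\notin\partial\mathbb{G}_t$,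 while if $Y_t\in\partial\mathbb{G}_t$ then both end points of every edge of $\mathbb{G}_{t+1}$ that is not in $\mathbb{G}_t$ lie in $\mathbb{B}(Y_t,1)$. This interaction is - *open by touch* if, whenever $Y_t\in\partial\mathbb{G}_t$, all edges of $\overline{\mathbb{G}}$ at $Y_t$ belong to $\mathbb{G}_{t+1}$; - *partially open by touch* if there is $\varepsilon>0$ such that, for all $t$, on $\{Y_t\in\partial\mathbb{G}_t\}$ the conditional probability given $\mathcal{F}_t$ that $\mathbb{G}_{t+1}$ contains an edge at $Y_t$ that is not in $\mathbb{G}_t$ is a.s. at least $\varepsilon$. The process $Y_t$ is an *extended simple random walk* if, for all $t$, a.s. on $\{Y_t\notin\partial\mathbb{G}_t\}$ the conditional law of $Y_{t+1}$ given $\mathcal{F}_t$ is uniform on the neighbours of $Y_t$ in $\overline{\mathbb{G}}$, and a.s. on $\{Y_t\in\partial\mathbb{G}_t\}$ one has $Y_{t+1}\in\mathcal{C}(Y_t)$ (with no other restriction on the choice of $Y_{t+1}$). Its sample path is *transient* if it visits every vertex only finitely often. **Proposition 1.6 (label obstacles).** Suppose that SRW on $\overline{\mathbb{G}}$ is transient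 and that $$S_\star:=\sum_{x\in\partial\mathbb{G}_0}\ \sup_{y\in\mathcal{C}(x)}\mathbb{P}_y(\text{SRW on }\overline{\mathbb{G}}\text{ ever hits }0)<\infty .$$ Then the sample path of every open by touch extended simple random walk is a.s. transient. If moreover the degrees of $\overline{\mathbb{G}}$ are uniformly bounded, then the sample path of every partially open by touch extended simple random walk is a.s. transient. In the case $\overline{\mathbb{G}}=\mathbb{Z}^d$ (nearest-neighbour graph), $d\ge3$, let $\mathbb{D}_0$ be the initial graph $\mathbb{G}_0$ and let $N(k)$ be the number of vertices of $\partial\mathbb{D}_0$ on the boundary of the box $[-k/2,k/2]^d$. If $\sum_{k\ge1}N(k)\,k^{2-d}<\infty$, then the sample path of every partially open by touch extended simple random walk is a.s. transient. -/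

import Mathlib

open MeasureTheory ProbabilityTheory
open scoped ENNReal

noncomputable section

namespace GrowingWalk

/-! ### Simple random walk on a fixed graph -/

section SRW

variable {V : Type*} [MeasurableSpace V] [DiscreteMeasurableSpace V]

open Classical in
/-- One-step transition law of simple random walk: the uniform distribution on the neighbours
of `x`. (At a vertex with no neighbour, or infinitely many, the walk stays put by convention; this
never matters on a connected locally finite graph with at least two vertices.) -/
def srwStep (G : SimpleGraph V) (x : V) : Measure V :=
  if (G.neighborSet x).Finite ∧ (G.neighborSet x).Nonempty then
    uniformOn (G.neighborSet x)
  else Measure.dirac x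

instance (G : SimpleGraph V) (x : V) : IsProbabilityMeasure (srwStep G x) := by
  unfold srwStep
  split_ifs with h
  · exact isProbabilityMeasure_uniformOn h.1 h.2
  · infer_instance

/-- The transition kernel of simple random walk on `G`. -/
def srwKernel (G : SimpleGraph V) : Kernel V V where
  toFun := srwStep G
  measurable' := Measurable.of_discrete

instance (G : SimpleGraph V) : IsMarkovKernel (srwKernel G) :=
  ⟨fun x => inferInstanceAs (IsProbabilityMeasure (srwStep G x))⟩

/-- The kernel giving the next position of simple random walk from its past: it only looks at the
present position. -/
def srwHistoryKernel (G : SimpleGraph V) (n : ℕ) :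
    Kernel ((i : Finset.Iic n) → (fun _ : ℕ => V) i) ((fun _ : ℕ => V) (n + 1)) :=
  (srwKernel G).comap (fun h => h ⟨n, Finset.mem_Iic.mpr le_rfl⟩) (measurable_pi_apply _)

instance (G : SimpleGraph V) (n : ℕ) : IsMarkovKernel (srwHistoryKernel G n) :=
  inferInstanceAs (IsMarkovKernel ((srwKernel G).comap _ _))

/-- The law `ℙ_y` on path space of simple random walk on `G` started at `y`. -/
def srwLaw (G : SimpleGraph V) (y : V) : Measure (ℕ → V) :=
  Kernel.trajMeasure (X := fun _ => V) (Measure.dirac y) (srwHistoryKernel G)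

/-- `ℙ_y (SRW on G ever hits o)`. -/
def hitProb (G : SimpleGraph V) (o y : V) : ℝ≥0∞ :=
  srwLaw G y {w | ∃ n, w n = o}

/-- Simple random walk on `G` is transient at `o`: started at `o`, it almost surely visits `o`
only finitely often. (For connected `G` this does not depend on `o`.) -/
def SRWTransient (G : SimpleGraph V) (o : V) : Prop :=
  ∀ᵐ w ∂(srwLaw G o), {n | w n = o}.Finite

end SRW

/-! ### Boundaries and balls -/

section Graph

variable {V : Type*}

/-- The boundary `{z : deg_H z < deg_Gbar z}` of a spanning subgraph `H` of the locally
finite graph `Gbar`. -/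
def boundary (Gbar H : SimpleGraph V) : Set V :=
  {z | (H.neighborSet z).ncard < (Gbar.neighborSet z).ncard}

/-- The closed ball of (real) radius `r` around `x` in the graph distance of the
connected graph `G`. -/
def ball (G : SimpleGraph V) (x : V) (r : ℝ) : Set V :=
  {y | (G.dist x y : ℝ) ≤ r}

/-- Admissible radii for the jumps of an extended simple random walk:
`1 ≤ r x ≤ max 1 (c * d(x, o))` for some constant `c < 1`. -/
def IsJumpRadius (Gbar : SimpleGraph V) (o : V) (r : V → ℝ) : Prop :=
  ∃ c < (1 : ℝ), ∀ x, 1 ≤ r x ∧ r x ≤ max 1 (c * Gbar.dist x o)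

variable [MeasurableSpace V] [DiscreteMeasurableSpace V]

/-- `S⋆`, the sum over `x ∈ ∂G0` of the supremum over `y` in the ball `C(x)` of radius `r x` around
`x` of the probability that simple random walk on `Gbar` started at `y` ever hits `o`. -/
def Sstar (Gbar G0 : SimpleGraph V) (o : V) (r : V → ℝ) : ℝ≥0∞ :=
  ∑' x : boundary Gbar G0, ⨆ y ∈ ball Gbar (x : V) (r x), hitProb Gbar o y

end Graph

/-! ### Interacting walks on growing spanning subgraphs -/

section Model

variable {V Ω : Type*} [MeasurableSpace V] [DiscreteMeasurableSpace V] {mΩ : MeasurableSpace Ω}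

/-- `G t`, `t ∈ ℕ`, is a random increasing sequence of spanning subgraphs of `Gbar`, adapted to
`𝓕` and started at the given graph `G0`, which grows by touch of the adapted sequence `Y t` of
sites: it can change between times `t` and `t + 1` only when `Y t` is in the boundary of `G t`, and
then the added edges lie in the closed unit ball of `Gbar` around `Y t`. -/
structure IsTouchGrowth (Gbar G0 : SimpleGraph V) (μ : Measure Ω)
    (𝓕 : Filtration ℕ mΩ)
    (G : ℕ → Ω → SimpleGraph V) (Y : ℕ → Ω → V) : Prop where
  adapted_graph : ∀ t x y, MeasurableSet[𝓕 t] {ω | (G t ω).Adj x y}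
  adapted_walk : ∀ t, Measurable[𝓕 t] (Y t)
  start : ∀ᵐ ω ∂μ, G 0 ω = G0
  le_ambient : ∀ t, ∀ᵐ ω ∂μ, G t ω ≤ Gbar
  mono : ∀ t, ∀ᵐ ω ∂μ, G t ω ≤ G (t + 1) ω
  eq_of_notMem : ∀ t, ∀ᵐ ω ∂μ, Y t ω ∉ boundary Gbar (G t ω) → G (t + 1) ω = G t ω
  added_near : ∀ t, ∀ᵐ ω ∂μ, ∀ a b, (G (t + 1) ω).Adj a b → ¬ (G t ω).Adj a b →
    a ∈ ball Gbar (Y t ω) 1 ∧ b ∈ ball Gbar (Y t ω) 1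

/-- Open by touch interaction: whenever `Y t` is in the boundary of `G t`, all edges of `Gbar` at
`Y t` are opened. By `added_near` the other edges of the closed unit ball, which join two
neighbours of `Y t`, may or may not be opened as well, so that both the rule 'add the edges at
`Y t`' and the rule 'add all edges of the subgraph induced on the ball' are instances. -/
structure IsOBT (Gbar G0 : SimpleGraph V) (μ : Measure Ω)
    (𝓕 : Filtration ℕ mΩ)
    (G : ℕ → Ω → SimpleGraph V) (Y : ℕ → Ω → V) : Prop
    extends IsTouchGrowth Gbar G0 μ 𝓕 G Y where
  opens : ∀ t, ∀ᵐ ω ∂μ, Y t ω ∈ boundary Gbar (G t ω) →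
    ∀ y, Gbar.Adj (Y t ω) y → (G (t + 1) ω).Adj (Y t ω) y

/-- Partially open by touch interaction: there is `ε > 0` such that whenever `Y t` is in the
boundary of `G t`, given the past at least one new edge at `Y t` is opened with probability at
least `ε`. -/
structure IsPOBT (Gbar G0 : SimpleGraph V) (μ : Measure Ω)
    (𝓕 : Filtration ℕ mΩ)
    (G : ℕ → Ω → SimpleGraph V) (Y : ℕ → Ω → V) : Prop
    extends IsTouchGrowth Gbar G0 μ 𝓕 G Y where
  opens_with_prob : ∃ ε > (0 : ℝ), ∀ t, ∀ᵐ ω ∂μ, Y t ω ∈ boundary Gbar (G t ω) →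
    ε ≤ (μ⟦{ω' | ∃ y, (G (t + 1) ω').Adj (Y t ω') y ∧ ¬ (G t ω').Adj (Y t ω') y} | 𝓕 t⟧) ω

/-- `Y` moves as an extended simple random walk started at `o`: given the past it makes a step of
simple random walk on `Gbar` when it is off the boundary of the current graph, while from a
boundary site `x` it may move in any (random, history-dependent) way inside the ball of
radius `r x` around `x`. -/
structure IsExtendedSRW (Gbar : SimpleGraph V) (o : V) (r : V → ℝ) (μ : Measure Ω)
    (𝓕 : Filtration ℕ mΩ)
    (G : ℕ → Ω → SimpleGraph V) (Y : ℕ → Ω → V) : Prop where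
  start : ∀ᵐ ω ∂μ, Y 0 ω = o
  step : ∀ t y, ∀ᵐ ω ∂μ, Y t ω ∉ boundary Gbar (G t ω) →
    (μ⟦{ω' | Y (t + 1) ω' = y} | 𝓕 t⟧) ω = (srwKernel Gbar (Y t ω)).real {y}
  jump : ∀ t, ∀ᵐ ω ∂μ, Y t ω ∈ boundary Gbar (G t ω) →
    Y (t + 1) ω ∈ ball Gbar (Y t ω) (r (Y t ω))

end Model

/-- The sample path `Y` is almost surely transient: almost surely every vertex is visited only
finitely often. -/
def AlmostSurelyTransient {V Ω : Type*} [MeasurableSpace Ω] (μ : Measure Ω)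
    (Y : ℕ → Ω → V) : Prop :=
  ∀ᵐ ω ∂μ, ∀ x, {t | Y t ω = x}.Finite

/-! ### The integer lattice -/

/-- The nearest-neighbour graph on `ℤ^d`. -/
def latticeGraph (d : ℕ) : SimpleGraph (Fin d → ℤ) where
  Adj x y := ∑ i, |x i - y i| = 1
  symm := ⟨fun x y h => by simpa only [abs_sub_comm] using h⟩
  loopless := ⟨fun x h => by simp at h⟩

/-- Lattice points on the boundary of the box `[-k/2, k/2]^d` of side length `k`. -/
def boxBoundary (d k : ℕ) : Set (Fin d → ℤ) :=
  {x | (∀ i, 2 * |x i| ≤ k) ∧ ∃ i, 2 * |x i| = k}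

/-- `N(k)`: the number of boundary sites of `D0` on the boundary of the box of side length `k`
centred at the origin. -/
def boxCount (d : ℕ) (D0 : SimpleGraph (Fin d → ℤ)) (k : ℕ) : ℕ :=
  (boundary (latticeGraph d) D0 ∩ boxBoundary d k).ncard

end GrowingWalk

end

open GrowingWalk

/-! Let h(y) be the probability that simple random walk started at y ever hits o. It is harmonic off
o, at most 1, and h(o) = 1; transience makes the defect δ = 1 - (mean of h over one step from o)
strictly positive (`stepMean_hitProb_self_lt_one`). Along the interacting walk, h(Y t) is a
supermartingale except at boundary visits, and a jump from the boundary site x leaves it at most sup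
of h over the ball C(x). Summing the one-step inequality `IsExtendedSRW.lintegral_step_le` over time
gives δ · E[visits to o] ≤ 1 + ∑ₓ (sup of h over C(x)) · E[visits to x while x is in the boundary].

The graph only grows, so only sites of the initial boundary contribute. If each has at most K
expected boundary visits, the right side is at most 1 + K · S⋆, which is finite. A full opening can
happen only once per site, so K = 1 for open by touch; in the partial case each boundary visit
raises the degree of the site with conditional probability at least ε, so K = D / ε for degrees at
most D.

Hence o is visited finitely often. A site x visited infinitely often makes all but finitely many of
these visits off the boundary, so conditional Borel–Cantelli makes each neighbour of x visited
infinitely often too (`IsExtendedSRW.infinite_visits_of_adj`). Following a path from x to o gives a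
contradiction.

On ℤ^d an explicit superharmonic function of order |x|^(2-d) proves that simple random walk is
transient and dominates h. Jump balls stay at a distance from 0 proportional to that of their
centre, up to an additive constant, so S⋆ is bounded by a multiple of the sum over boxes. -/

noncomputable section

namespace GrowingWalk

set_option linter.unusedSectionVars false

/-! ### Hitting probabilities of simple random walk -/

section HittingProbability

open Filter

variable {V : Type*} [MeasurableSpace V] [DiscreteMeasurableSpace V] {G : SimpleGraph V} {o : V}

/-- The one-step average of a function under simple random walk. -/
def stepMean (G : SimpleGraph V) (f : V → ℝ≥0∞) (y : V) : ℝ≥0∞ := ∫⁻ z, f z ∂(srwStep G y)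

lemma stepMean_mono {f g : V → ℝ≥0∞} (h : ∀ y, f y ≤ g y) (y : V) :
    stepMean G f y ≤ stepMean G g y := lintegral_mono h

lemma stepMean_le_one {f : V → ℝ≥0∞} (h : ∀ y, f y ≤ 1) (y : V) : stepMean G f y ≤ 1 :=
  (lintegral_mono h).trans (by simp)

instance (G : SimpleGraph V) (y : V) : IsProbabilityMeasure (srwLaw G y) :=
  inferInstanceAs (IsProbabilityMeasure
    (Kernel.trajMeasure (X := fun _ => V) (Measure.dirac y) (srwHistoryKernel G)))

lemma srwStep_singleton_pos {y z : V} (hfin : (G.neighborSet y).Finite) (hyz : G.Adj y z) :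
    0 < srwStep G y {z} := by
  have hne : (G.neighborSet y).Nonempty := ⟨z, hyz⟩
  rw [srwStep, if_pos ⟨hfin, hne⟩, pos_iff_ne_zero, ne_eq, uniformOn_eq_zero_iff hfin]
  intro h
  exact (h ▸ (⟨hyz, rfl⟩ : z ∈ G.neighborSet y ∩ {z}) : z ∈ (∅ : Set V))

/-- The Markov property of simple random walk at a fixed time. -/
lemma srwLaw_lintegral_succ (y : V) (n : ℕ) {B : Set ((i : Finset.Iic n) → V)}
    (hB : MeasurableSet B) (g : V → ℝ≥0∞) :
    ∫⁻ w in {w : ℕ → V | Preorder.frestrictLe (π := fun _ => V) n w ∈ B}, g (w (n + 1))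
        ∂(srwLaw G y) =
      ∫⁻ w in {w : ℕ → V | Preorder.frestrictLe (π := fun _ => V) n w ∈ B}, stepMean G g (w n)
        ∂(srwLaw G y) := by
  -- The joint law of the past up to n and the next position is the law of the past composed with
  -- the step kernel; both are tested against 1_B · g.
  have key := Kernel.map_frestrictLe_trajMeasure_compProd_eq_map_trajMeasure
    (X := fun _ => V) (μ₀ := Measure.dirac y) (κ := srwHistoryKernel G) (a := n)
  have hgm : Measurable g := Measurable.of_discrete
  have hmB : MeasurableSet {w : ℕ → V | Preorder.frestrictLe (π := fun _ => V) n w ∈ B} :=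
    (Preorder.measurable_frestrictLe (X := fun _ => V) n) hB
  have hΦ : Measurable fun p : ((i : Finset.Iic n) → V) × V => B.indicator 1 p.1 * g p.2 := by
    refine Measurable.mul ?_ (hgm.comp measurable_snd)
    exact (measurable_one.indicator hB).comp measurable_fst
  have h1 := congrArg (fun m => ∫⁻ p, B.indicator 1 p.1 * g p.2 ∂m) key
  rw [Measure.lintegral_compProd hΦ, lintegral_map hΦ (by fun_prop), lintegral_map _ (by fun_prop)]
    at h1
  · rw [← lintegral_indicator hmB, ← lintegral_indicator hmB]
    refine Eq.trans ?_ (h1.symm.trans ?_)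
    · refine lintegral_congr fun w => ?_
      by_cases hw : Preorder.frestrictLe (π := fun _ => V) n w ∈ B <;> simp [hw]
    · refine lintegral_congr fun w => ?_
      dsimp only
      rw [lintegral_const_mul _ hgm]
      by_cases hw : Preorder.frestrictLe (π := fun _ => V) n w ∈ B
      · simp [hw]; rfl
      · simp [hw]
  · exact hΦ.lintegral_kernel_prod_right'

lemma measurableSet_visit (o : V) (k : ℕ) : MeasurableSet {w : ℕ → V | w k = o} :=
  (measurable_pi_apply (X := fun _ : ℕ => V) k) (measurableSet_singleton o)

lemma srwLaw_start (y : V) : ∀ᵐ w ∂(srwLaw G y), w 0 = y := by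
  have h1 : (srwLaw G y).map (Preorder.frestrictLe (π := fun _ => V) 0) =
      (Measure.dirac y).map
        (MeasurableEquiv.piUnique (fun _ : Finset.Iic (0 : ℕ) => V)).symm := by
    unfold srwLaw Kernel.trajMeasure
    rw [Measure.map_comp _ _ (by fun_prop), Kernel.traj_map_frestrictLe, Kernel.partialTraj_self,
      Measure.id_comp]
  have h3 : (Measure.dirac y).map
        (MeasurableEquiv.piUnique (fun _ : Finset.Iic (0 : ℕ) => V)).symm =
      Measure.dirac ((MeasurableEquiv.piUnique (fun _ : Finset.Iic (0 : ℕ) => V)).symm y) :=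
    Measure.map_dirac' (MeasurableEquiv.measurable _) y
  rw [h3] at h1
  have h2 : ∀ᵐ h ∂((srwLaw G y).map (Preorder.frestrictLe (π := fun _ => V) 0)),
      h ⟨0, by simp⟩ = y := by
    rw [h1, ae_dirac_iff]
    · rfl
    · exact (measurable_pi_apply (X := fun _ : Finset.Iic (0 : ℕ) => V) ⟨0, by simp⟩)
        (measurableSet_singleton y)
  exact ae_of_ae_map (by fun_prop) h2

/-- The probability that simple random walk started at `y` hits `o` within `n` steps. -/
def hitWithin (G : SimpleGraph V) (o : V) : ℕ → V → ℝ≥0∞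
  | 0 => Set.indicator {o} 1
  | n + 1 => fun y => Set.indicator {o} 1 y + Set.indicator {o}ᶜ (stepMean G (hitWithin G o n)) y

@[simp] lemma hitWithin_self (n : ℕ) : hitWithin G o n o = 1 := by
  cases n <;> simp [hitWithin]

lemma hitWithin_succ_of_ne (n : ℕ) {y : V} (hy : y ≠ o) :
    hitWithin G o (n + 1) y = stepMean G (hitWithin G o n) y := by
  simp [hitWithin, hy]

lemma hitWithin_le_succ (n : ℕ) (y : V) : hitWithin G o n y ≤ hitWithin G o (n + 1) y := by
  induction n generalizing y with
  | zero => by_cases hy : y = o <;> simp [hitWithin, hy]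
  | succ n ih =>
    by_cases hy : y = o
    · simp [hy]
    · rw [hitWithin_succ_of_ne _ hy, hitWithin_succ_of_ne _ hy]
      exact stepMean_mono ih y

lemma hitWithin_le_of_superharmonic {f : V → ℝ≥0∞} (ho : 1 ≤ f o)
    (hf : ∀ y, stepMean G f y ≤ f y) (n : ℕ) (y : V) : hitWithin G o n y ≤ f y := by
  induction n generalizing y with
  | zero => by_cases hy : y = o <;> simp [hitWithin, hy, ho]
  | succ n ih =>
    by_cases hy : y = o
    · simpa [hy] using ho
    · rw [hitWithin_succ_of_ne _ hy]
      exact (stepMean_mono ih y).trans (hf y)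

/-- Only the one-step Markov property is used: time is released one unit at a time, the paths that
have missed o during [n, n + j] carrying the hitting probability for the remaining N - j steps. -/
lemma lintegral_hitWithin (y : V) (n N : ℕ) :
    ∫⁻ w, hitWithin G o N (w n) ∂(srwLaw G y) =
      srwLaw G y {w | ∃ k, n ≤ k ∧ k ≤ n + N ∧ w k = o} := by
  have hev : ∀ k, MeasurableSet {w : ℕ → V | w k = o} := measurableSet_visit o
  set A : ℕ → Set (ℕ → V) := fun j => {w | ∃ k, n ≤ k ∧ k ≤ n + j ∧ w k = o} with hA
  have hAm : ∀ j, MeasurableSet (A j) := fun j => by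
    have : A j = ⋃ k ∈ {k | n ≤ k ∧ k ≤ n + j}, {w : ℕ → V | w k = o} := by
      ext w; simp [hA, and_assoc]
    rw [this]
    exact MeasurableSet.biUnion (Set.to_countable _) fun k _ => hev k
  have hAB : ∀ j, ∃ B : Set ((i : Finset.Iic (n + j)) → V), MeasurableSet B ∧
      (A j)ᶜ = {w : ℕ → V | Preorder.frestrictLe (π := fun _ => V) (n + j) w ∈ B} := fun j => by
    refine ⟨⋂ k : {k : Finset.Iic (n + j) // n ≤ (k : ℕ)}, {h | h k.1 ≠ o},
      MeasurableSet.iInter fun k => ?_, ?_⟩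
    · exact ((measurable_pi_apply (X := fun _ : Finset.Iic (n + j) => V) k.1)
        (measurableSet_singleton o)).compl
    · ext w
      simp [hA]
      exact ⟨fun h k h1 h2 => h k h2 h1, fun h k h1 h2 => h k h2 h1⟩
  have hstep : ∀ j ≤ N, ∫⁻ w, hitWithin G o N (w n) ∂(srwLaw G y) =
      srwLaw G y (A j) + ∫⁻ w in (A j)ᶜ, hitWithin G o (N - j) (w (n + j)) ∂(srwLaw G y) := by
    intro j
    induction j with
    | zero =>
      intro _
      have hA0 : A 0 = {w | w n = o} := by
        ext w; constructor
        · rintro ⟨k, h1, h2, h3⟩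
          obtain rfl : k = n := by omega
          exact h3
        · exact fun h => ⟨n, le_rfl, by simp, h⟩
      rw [← lintegral_add_compl _ (hAm 0)]
      congr 1
      rw [setLIntegral_congr_fun (g := fun _ => 1) (hAm 0)]
      · simp
      · intro w hw
        rw [hA0] at hw
        have : w n = o := hw
        simp [this]
    | succ j ih =>
      intro hj
      rw [ih (by omega)]
      obtain ⟨m, hm⟩ : ∃ m, N - j = m + 1 := ⟨N - j - 1, by omega⟩
      have hm' : N - (j + 1) = m := by omega
      rw [hm, hm']
      have hsub : A j ⊆ A (j + 1) := fun w ⟨k, h1, h2, h3⟩ => ⟨k, h1, by omega, h3⟩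
      have e1 : ∫⁻ w in (A j)ᶜ, hitWithin G o (m + 1) (w (n + j)) ∂(srwLaw G y) =
          ∫⁻ w in (A j)ᶜ, hitWithin G o m (w (n + (j + 1))) ∂(srwLaw G y) := by
        obtain ⟨B, hB, hBA⟩ := hAB j
        have := srwLaw_lintegral_succ (G := G) y (n + j) hB (hitWithin G o m)
        rw [← hBA] at this
        rw [← add_assoc, this]
        refine setLIntegral_congr_fun (hAm j).compl fun w hw => ?_
        refine hitWithin_succ_of_ne _ fun h => hw ⟨n + j, by omega, le_rfl, h⟩
      have e2 : ∫⁻ w in (A j)ᶜ, hitWithin G o m (w (n + (j + 1))) ∂(srwLaw G y) =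
          srwLaw G y (A (j + 1) \ A j) +
            ∫⁻ w in (A (j + 1))ᶜ, hitWithin G o m (w (n + (j + 1))) ∂(srwLaw G y) := by
        rw [← lintegral_inter_add_sdiff _ (A j)ᶜ (hAm (j + 1))]
        congr 1
        · rw [setLIntegral_congr_fun (g := fun _ => 1) ((hAm j).compl.inter (hAm (j + 1)))]
          · rw [setLIntegral_one, Set.sdiff_eq, Set.inter_comm]
          · rintro w ⟨hw1, k, h1, h2, h3⟩
            have : k = n + (j + 1) := by
              by_contra hk
              exact hw1 ⟨k, h1, by omega, h3⟩
            simp [← this, h3]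
        · rw [Set.sdiff_eq, ← Set.compl_union, Set.union_eq_self_of_subset_left hsub]
      rw [e1, e2, ← add_assoc, measure_add_sdiff (hAm j).nullMeasurableSet,
        Set.union_eq_self_of_subset_left hsub]
  -- At j = N the remainder vanishes: no steps are left and the walk is not at o.
  rw [hstep N le_rfl, setLIntegral_congr_fun (g := fun _ => 0) (hAm N).compl]
  · simp [hA]
  · intro w hw
    have : w (n + N) ≠ o := fun h => hw ⟨n + N, by omega, le_rfl, h⟩
    simp [hitWithin, this]

lemma hitWithin_mono (y : V) : Monotone fun n => hitWithin G o n y :=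
  monotone_nat_of_le_succ fun n => hitWithin_le_succ n y

lemma hitProb_eq_iSup (y : V) : hitProb G o y = ⨆ n, hitWithin G o n y := by
  have h1 : {w : ℕ → V | ∃ n, w n = o} = ⋃ N, {w | ∃ k, 0 ≤ k ∧ k ≤ 0 + N ∧ w k = o} := by
    ext w
    simp only [Set.mem_ofPred_eq, Set.mem_iUnion]
    exact ⟨fun ⟨n, h⟩ => ⟨n, n, by simp, by simp, h⟩, fun ⟨_, k, _, _, h⟩ => ⟨k, h⟩⟩
  rw [hitProb, h1, Monotone.measure_iUnion]
  · refine iSup_congr fun N => ?_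
    rw [← lintegral_hitWithin, lintegral_congr_ae (g := fun _ => hitWithin G o N y)]
    · simp
    · filter_upwards [srwLaw_start (G := G) y] with w hw
      rw [hw]
  · rintro a b hab w ⟨k, h1, h2, h3⟩
    exact ⟨k, h1, by omega, h3⟩

@[simp] lemma hitProb_self : hitProb G o o = 1 := by simp [hitProb_eq_iSup]

lemma hitProb_le_one (y : V) : hitProb G o y ≤ 1 := prob_le_one

lemma hitProb_of_ne {y : V} (hy : y ≠ o) : hitProb G o y = stepMean G (hitProb G o) y := by
  have : stepMean G (hitProb G o) y = ⨆ n, stepMean G (hitWithin G o n) y := by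
    unfold stepMean
    rw [← lintegral_iSup (fun n => Measurable.of_discrete)]
    · simp_rw [hitProb_eq_iSup]
    · intro a b hab z
      exact hitWithin_mono z hab
  rw [this, hitProb_eq_iSup, ← (hitWithin_mono y).iSup_nat_add 1]
  exact iSup_congr fun n => hitWithin_succ_of_ne n hy

/-- Minimality of the hitting probability: any explicit superharmonic function that is at least 1 at
o becomes an upper bound. -/
lemma hitProb_le_of_superharmonic {f : V → ℝ≥0∞} (ho : 1 ≤ f o)
    (hf : ∀ y, stepMean G f y ≤ f y) (y : V) : hitProb G o y ≤ f y := by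
  rw [hitProb_eq_iSup]
  exact iSup_le fun n => hitWithin_le_of_superharmonic ho hf n y

lemma lintegral_hitProb (y : V) (n : ℕ) :
    ∫⁻ w, hitProb G o (w n) ∂(srwLaw G y) = srwLaw G y {w | ∃ k, n ≤ k ∧ w k = o} := by
  have h1 : {w : ℕ → V | ∃ k, n ≤ k ∧ w k = o} = ⋃ N, {w | ∃ k, n ≤ k ∧ k ≤ n + N ∧ w k = o} := by
    ext w
    simp only [Set.mem_ofPred_eq, Set.mem_iUnion]
    exact ⟨fun ⟨k, h, h'⟩ => ⟨k, k, h, by simp, h'⟩, fun ⟨_, k, h, _, h'⟩ => ⟨k, h, h'⟩⟩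
  rw [h1, Monotone.measure_iUnion]
  · simp_rw [← lintegral_hitWithin]
    rw [← lintegral_iSup]
    · simp_rw [hitProb_eq_iSup]
    · intro N
      exact (Measurable.of_discrete (f := hitWithin G o N)).comp (measurable_pi_apply n)
    · intro a b hab w
      exact hitWithin_mono _ hab
  · rintro a b hab w ⟨k, h1, h2, h3⟩
    exact ⟨k, h1, by omega, h3⟩

/-- A function bounded by one whose average over the neighbours is one equals one at all
neighbours. -/
lemma eq_one_of_stepMean_eq_one {f : V → ℝ≥0∞} (hf : ∀ y, f y ≤ 1) {y z : V}
    (hfin : (G.neighborSet y).Finite) (hyz : G.Adj y z) (h : stepMean G f y = 1) : f z = 1 := by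
  have hae : ∀ᵐ x ∂(srwStep G y), 1 ≤ f x := by
    refine (ae_eq_of_ae_le_of_lintegral_le (g := fun _ => 1) (ae_of_all _ hf) ?_
      aemeasurable_const ?_).symm.le
    · exact ne_of_eq_of_ne h ENNReal.one_ne_top
    · simpa using (show 1 ≤ ∫⁻ x, f x ∂srwStep G y from h.ge)
  by_contra hz
  have hz' : srwStep G y {z} = 0 := by
    refine measure_mono_null ?_ (ae_iff.mp hae)
    rintro _ rfl
    exact fun h1 => hz (le_antisymm (hf _) h1)
  exact (srwStep_singleton_pos hfin hyz).ne' hz'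

/-- If simple random walk is transient, then it fails to return to `o` with positive probability. -/
lemma stepMean_hitProb_self_lt_one (hconn : G.Connected) (hfin : ∀ x, (G.neighborSet x).Finite)
    (htr : SRWTransient G o) : stepMean G (hitProb G o) o < 1 := by
  refine lt_of_le_of_ne (stepMean_le_one hitProb_le_one o) fun h1 => ?_
  -- Maximum principle: the value 1 spreads from each site to its neighbours, hence everywhere. Then
  -- o is visited after every time n almost surely, against transience.
  have hall : ∀ y, hitProb G o y = 1 := by
    intro y
    obtain ⟨p⟩ := hconn.preconnected o y
    have : ∀ {x z : V} (p : G.Walk x z), hitProb G o x = 1 → hitProb G o z = 1 := by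
      intro x z p
      induction p with
      | nil => exact id
      | @cons a b c hab _ ih =>
        intro ha
        refine ih (eq_one_of_stepMean_eq_one hitProb_le_one (hfin a) hab ?_)
        by_cases hao : a = o
        · rw [hao, h1]
        · rw [← hitProb_of_ne hao, ha]
    exact this p hitProb_self
  have hio : ∀ n, ∀ᵐ w ∂(srwLaw G o), ∃ k, n ≤ k ∧ w k = o := by
    intro n
    refine (mem_ae_iff_prob_eq_one ?_).mpr ?_
    · have : {w : ℕ → V | ∃ k, n ≤ k ∧ w k = o} = ⋃ k ∈ {k | n ≤ k}, {w | w k = o} := by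
        ext w; simp
      rw [this]
      exact MeasurableSet.biUnion (Set.to_countable _) fun k _ => measurableSet_visit o k
    · rw [← lintegral_hitProb]
      simp [hall]
  have : ∀ᵐ w ∂(srwLaw G o), False := by
    filter_upwards [htr, ae_all_iff.mpr hio] with w hw hw'
    obtain ⟨b, hb⟩ := hw.bddAbove
    obtain ⟨k, hk, hk'⟩ := hw' (b + 1)
    have : k ≤ b := hb hk'
    omega
  rw [ae_iff] at this
  simp at this

end HittingProbability

/-! ### Telescoping and counting tools -/

section Growth

open Filter

lemma countable_of_connected {V : Type*} {G : SimpleGraph V} (hconn : G.Connected)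
    (hfin : ∀ x, (G.neighborSet x).Finite) : Countable V := by
  obtain ⟨o⟩ := hconn.nonempty
  have hlen : ∀ n : ℕ, {y | ∃ p : G.Walk y o, p.length = n}.Countable := by
    intro n
    induction n with
    | zero =>
      refine (Set.countable_singleton o).mono ?_
      rintro y ⟨p, hp⟩
      exact p.eq_of_length_eq_zero hp
    | succ n ih =>
      refine (ih.biUnion fun y _ => (hfin y).countable).mono ?_
      rintro z ⟨p, hp⟩
      cases p with
      | nil => simp at hp
      | @cons _ y _ hzy q =>
        simp only [Set.mem_iUnion]
        exact ⟨y, ⟨q, by simpa using hp⟩, hzy.symm⟩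
  refine Set.countable_univ_iff.mp ((Set.countable_iUnion hlen).mono fun y _ => ?_)
  obtain ⟨p⟩ := hconn.preconnected y o
  exact Set.mem_iUnion.mpr ⟨p.length, p, rfl⟩

lemma mem_boundary_iff {V : Type*} {Gbar H : SimpleGraph V} {x : V} (hle : H ≤ Gbar)
    (hfin : (Gbar.neighborSet x).Finite) :
    x ∈ boundary Gbar H ↔ ∃ y, Gbar.Adj x y ∧ ¬ H.Adj x y := by
  constructor
  · intro hx
    by_contra! hcon
    exact absurd (Set.ncard_le_ncard (s := Gbar.neighborSet x) (t := H.neighborSet x)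
      (fun y hy => hcon y hy) (hfin.subset fun y hy => hle hy)) (not_le.mpr hx)
  · rintro ⟨y, hy, hy'⟩
    exact Set.ncard_lt_ncard ⟨fun z hz => hle hz, fun h => hy' (h hy)⟩ hfin

/-- Telescoping of a potential a with losses p and gains b, kept additive because subtraction in
`ℝ≥0∞` is truncated. -/
lemma sum_add_le_of_step {a b p : ℕ → ℝ≥0∞} (h : ∀ n, a (n + 1) + p n ≤ a n + b n) (n : ℕ) :
    ∑ i ∈ Finset.range n, p i + a n ≤ a 0 + ∑ i ∈ Finset.range n, b i := by
  induction n with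
  | zero => simp
  | succ n ih =>
    rw [Finset.sum_range_succ, Finset.sum_range_succ]
    calc ∑ i ∈ Finset.range n, p i + p n + a (n + 1)
        = ∑ i ∈ Finset.range n, p i + (a (n + 1) + p n) := by ring
      _ ≤ ∑ i ∈ Finset.range n, p i + (a n + b n) := add_le_add le_rfl (h n)
      _ = (∑ i ∈ Finset.range n, p i + a n) + b n := by ring
      _ ≤ (a 0 + ∑ i ∈ Finset.range n, b i) + b n := by gcongr
      _ = _ := by ring

lemma tsum_le_of_step {a b p : ℕ → ℝ≥0∞} (h : ∀ n, a (n + 1) + p n ≤ a n + b n) :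
    ∑' n, p n ≤ a 0 + ∑' n, b n := by
  refine ENNReal.tsum_le_of_sum_range_le fun n => ?_
  exact (le_self_add.trans (sum_add_le_of_step h n)).trans
    (by gcongr; exact ENNReal.sum_le_tsum _)

/-- If a bounded integer quantity never decreases, and increases on each of the events `A t`,
then the expected number of these events that occur is at most the bound. -/
lemma tsum_measure_le_of_potential {Ω : Type*} {mΩ : MeasurableSpace Ω} {μ : Measure Ω}
    [IsProbabilityMeasure μ] {A : ℕ → Set Ω} (hA : ∀ t, MeasurableSet (A t))
    (φ : ℕ → Ω → ℕ) (K : ℕ) (hK : ∀ᵐ ω ∂μ, ∀ t, φ t ω ≤ K)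
    (hmono : ∀ᵐ ω ∂μ, ∀ t, φ t ω ≤ φ (t + 1) ω)
    (hinc : ∀ᵐ ω ∂μ, ∀ t, ω ∈ A t → φ t ω < φ (t + 1) ω) :
    ∑' t, μ (A t) ≤ K := by
  have h1 : ∑' t, μ (A t) = ∫⁻ ω, ∑' t, (A t).indicator 1 ω ∂μ := by
    rw [lintegral_tsum fun t => (measurable_one.indicator (hA t)).aemeasurable]
    simp [lintegral_indicator_one (hA _)]
  rw [h1]
  have h2 : ∀ᵐ ω ∂μ, ∑' t, (A t).indicator (1 : Ω → ℝ≥0∞) ω ≤ K := by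
    filter_upwards [hK, hmono, hinc] with ω hK hmono hinc
    refine ENNReal.tsum_le_of_sum_range_le fun n => ?_
    have : ∑ t ∈ Finset.range n, (A t).indicator (1 : Ω → ℝ≥0∞) ω ≤ (φ n ω : ℝ≥0∞) := by
      induction n with
      | zero => simp
      | succ n ih =>
        rw [Finset.sum_range_succ]
        by_cases hω : ω ∈ A n
        · rw [Set.indicator_of_mem hω]
          calc _ ≤ (φ n ω : ℝ≥0∞) + 1 := by gcongr; rfl
            _ ≤ _ := by exact_mod_cast hinc n hω
        · rw [Set.indicator_of_notMem hω, add_zero]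
          exact ih.trans (by exact_mod_cast hmono n)
    exact this.trans (by exact_mod_cast hK n)
  calc _ ≤ ∫⁻ _, (K : ℝ≥0∞) ∂μ := lintegral_mono_ae h2
    _ = K := by simp

/-! ### Expected number of boundary visits to a site -/

variable {V Ω : Type*} [MeasurableSpace V] [DiscreteMeasurableSpace V] {mΩ : MeasurableSpace Ω}
  {Gbar G0 : SimpleGraph V} {o : V} {r : V → ℝ} {μ : Measure Ω} {𝓕 : Filtration ℕ mΩ}
  {G : ℕ → Ω → SimpleGraph V} {Y : ℕ → Ω → V}

/-- The event that at time `t` the walk is at the boundary site `x`. -/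
def boundaryVisit (Gbar : SimpleGraph V) (G : ℕ → Ω → SimpleGraph V) (Y : ℕ → Ω → V) (t : ℕ)
    (x : V) : Set Ω :=
  {ω | Y t ω = x ∧ ∃ y, Gbar.Adj x y ∧ ¬ (G t ω).Adj x y}

/-- The event that at time `t` an edge at the current site is opened. -/
def opening (G : ℕ → Ω → SimpleGraph V) (Y : ℕ → Ω → V) (t : ℕ) : Set Ω :=
  {ω | ∃ y, (G (t + 1) ω).Adj (Y t ω) y ∧ ¬ (G t ω).Adj (Y t ω) y}

namespace IsTouchGrowth

variable (hg : IsTouchGrowth Gbar G0 μ 𝓕 G Y)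
include hg

lemma ae_regular : ∀ᵐ ω ∂μ, G 0 ω = G0 ∧ (∀ t, G t ω ≤ Gbar) ∧ Monotone fun t => G t ω := by
  filter_upwards [hg.start, ae_all_iff.mpr hg.le_ambient, ae_all_iff.mpr hg.mono] with ω h1 h2 h3
  exact ⟨h1, h2, monotone_nat_of_le_succ h3⟩

/-- Trades the degree comparison in `boundary` for a missing edge, which is a countable combination
of adapted events. -/
lemma ae_mem_boundary_iff (hfin : ∀ x, (Gbar.neighborSet x).Finite) : ∀ᵐ ω ∂μ, ∀ t,
    Y t ω ∈ boundary Gbar (G t ω) ↔ ω ∈ boundaryVisit Gbar G Y t (Y t ω) := by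
  filter_upwards [hg.ae_regular] with ω h t
  rw [mem_boundary_iff (h.2.1 t) (hfin _)]
  simp [boundaryVisit]

lemma measurableSet_visit (t : ℕ) (x : V) : MeasurableSet[𝓕 t] {ω | Y t ω = x} :=
  hg.adapted_walk t (measurableSet_singleton x)

lemma measurableSet_boundaryVisit [Countable V] (t : ℕ) (x : V) :
    MeasurableSet[𝓕 t] (boundaryVisit Gbar G Y t x) := by
  have : boundaryVisit Gbar G Y t x =
      {ω | Y t ω = x} ∩ ⋃ y, ⋃ _ : Gbar.Adj x y, {ω | (G t ω).Adj x y}ᶜ := by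
    ext ω; simp [boundaryVisit]
  rw [this]
  refine (hg.measurableSet_visit t x).inter (MeasurableSet.iUnion fun y =>
    MeasurableSet.iUnion fun _ => (hg.adapted_graph t x y).compl)

lemma measurableSet_opening [Countable V] (t : ℕ) : MeasurableSet (opening G Y t) := by
  have : opening G Y t = ⋃ x, ⋃ y, {ω | Y t ω = x} ∩
      ({ω | (G (t + 1) ω).Adj x y} ∩ {ω | (G t ω).Adj x y}ᶜ) := by
    ext ω; simp [opening]
  rw [this]
  exact MeasurableSet.iUnion fun x => MeasurableSet.iUnion fun y =>
    (𝓕.le t _ (hg.measurableSet_visit t x)).inter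
      ((𝓕.le _ _ (hg.adapted_graph (t + 1) x y)).inter
        (𝓕.le _ _ (hg.adapted_graph t x y)).compl)

/-- Edges never close, so the boundary never gains a site. This confines the gains to the initial
boundary and keeps o outside it. -/
lemma measure_boundaryVisit_eq_zero (hfin : ∀ x, (Gbar.neighborSet x).Finite)
    (hG0 : G0 ≤ Gbar) (t : ℕ) {x : V} (hx : x ∉ boundary Gbar G0) :
    μ (boundaryVisit Gbar G Y t x) = 0 := by
  refine measure_mono_null ?_ (ae_iff.mp hg.ae_regular)
  rintro ω ⟨_, y, h1, h2⟩ ⟨h3, _, h5⟩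
  refine hx ((mem_boundary_iff hG0 (hfin x)).mpr ⟨y, h1, fun h => h2 ?_⟩)
  have h6 := h5 (Nat.zero_le t)
  exact h6 (by simpa [h3] using h)

end IsTouchGrowth

/-- The potential is the indicator that all edges at x are open: a boundary visit switches it from 0
to 1 for good. -/
lemma IsOBT.tsum_boundaryVisit_le [Countable V] [IsProbabilityMeasure μ]
    (hg : IsOBT Gbar G0 μ 𝓕 G Y) (hfin : ∀ x, (Gbar.neighborSet x).Finite) (x : V) :
    ∑' t, μ (boundaryVisit Gbar G Y t x) ≤ 1 := by
  classical
  have hT := hg.toIsTouchGrowth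
  have := tsum_measure_le_of_potential (μ := μ) (A := fun t => boundaryVisit Gbar G Y t x)
    (fun t => 𝓕.le t _ (hT.measurableSet_boundaryVisit t x))
    (fun t ω => if ∀ y, Gbar.Adj x y → (G t ω).Adj x y then 1 else 0) 1
    (ae_of_all _ fun ω t => by split_ifs <;> simp) ?_ ?_
  · simpa using this
  · filter_upwards [hT.ae_regular] with ω hω t
    by_cases h : ∀ y, Gbar.Adj x y → (G t ω).Adj x y
    · have h' : ∀ y, Gbar.Adj x y → (G (t + 1) ω).Adj x y := fun y hy =>
        hω.2.2 (Nat.le_succ t) (h y hy)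
      rw [if_pos h, if_pos h']
    · rw [if_neg h]
      exact Nat.zero_le _
  · filter_upwards [hT.ae_mem_boundary_iff hfin, ae_all_iff.mpr hg.opens] with ω hω ho t ht
    have hx : Y t ω = x := ht.1
    have h1 : ¬ ∀ y, Gbar.Adj x y → (G t ω).Adj x y := by
      obtain ⟨y, h1, h2⟩ := ht.2
      exact fun h => h2 (h y h1)
    have h2 := ho t ((hω t).mpr (hx ▸ ht))
    rw [hx] at h2
    have h2' : ∀ y, Gbar.Adj x y → (G (t + 1) ω).Adj x y := h2
    rw [if_neg h1, if_pos h2']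
    exact zero_lt_one

/-- A boundary visit is known at time t, so at least a fraction ε of its probability also sees an
opening. With the degree of x as potential, at most D openings occur at x, whence K = D / ε. -/
lemma IsPOBT.exists_tsum_boundaryVisit_le [Countable V] [IsProbabilityMeasure μ]
    (hg : IsPOBT Gbar G0 μ 𝓕 G Y) (hfin : ∀ x, (Gbar.neighborSet x).Finite)
    {D : ℕ} (hD : ∀ x, (Gbar.neighborSet x).ncard ≤ D) :
    ∃ K : ℝ≥0∞, K ≠ ∞ ∧ ∀ x, ∑' t, μ (boundaryVisit Gbar G Y t x) ≤ K := by
  obtain ⟨ε, hε, hop⟩ := hg.opens_with_prob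
  have hT := hg.toIsTouchGrowth
  have hε' : ENNReal.ofReal ε ≠ 0 := by simpa using hε
  refine ⟨(ENNReal.ofReal ε)⁻¹ * D, ENNReal.mul_ne_top (by simpa using hε) (by simp),
    fun x => ?_⟩
  have hm := fun t => 𝓕.le t _ (hT.measurableSet_boundaryVisit t x)
  have h1 : ∀ t, ENNReal.ofReal ε * μ (boundaryVisit Gbar G Y t x) ≤
      μ (boundaryVisit Gbar G Y t x ∩ opening G Y t) := by
    intro t
    have hi : Integrable ((opening G Y t).indicator fun _ => (1 : ℝ)) μ :=
      (integrable_const 1).indicator (hT.measurableSet_opening t)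
    have e1 := setIntegral_condExp (𝓕.le t) hi (hT.measurableSet_boundaryVisit t x)
    have e2 : ∫ ω in boundaryVisit Gbar G Y t x, (opening G Y t).indicator (fun _ => (1 : ℝ)) ω ∂μ
        = μ.real (boundaryVisit Gbar G Y t x ∩ opening G Y t) := by
      rw [setIntegral_indicator (hT.measurableSet_opening t)]
      simp
    have e3 : ε * μ.real (boundaryVisit Gbar G Y t x) ≤
        ∫ ω in boundaryVisit Gbar G Y t x,
          (μ[(opening G Y t).indicator fun _ => (1 : ℝ) | 𝓕 t]) ω ∂μ := by
      have : ε * μ.real (boundaryVisit Gbar G Y t x) =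
          ∫ ω in boundaryVisit Gbar G Y t x, ε ∂μ := by simp [mul_comm]
      rw [this]
      refine setIntegral_mono_on_ae (integrable_const ε).integrableOn
        integrable_condExp.integrableOn (hm t) ?_
      filter_upwards [hop t, hT.ae_mem_boundary_iff hfin] with ω h1 h2 h3
      have hx : Y t ω = x := h3.1
      exact h1 ((h2 t).mpr (hx ▸ h3))
    rw [e1, e2] at e3
    rw [← ofReal_measureReal (s := boundaryVisit Gbar G Y t x), ← ENNReal.ofReal_mul hε.le,
      ← ofReal_measureReal (s := boundaryVisit Gbar G Y t x ∩ opening G Y t)]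
    exact ENNReal.ofReal_le_ofReal e3
  have h2 : ∑' t, μ (boundaryVisit Gbar G Y t x ∩ opening G Y t) ≤ D := by
    refine tsum_measure_le_of_potential (fun t => (hm t).inter (hT.measurableSet_opening t))
      (fun t ω => ((G t ω).neighborSet x).ncard) D ?_ ?_ ?_
    · filter_upwards [hT.ae_regular] with ω hω t
      exact (Set.ncard_le_ncard (fun y hy => hω.2.1 t hy) (hfin x)).trans (hD x)
    · filter_upwards [hT.ae_regular] with ω hω t
      exact Set.ncard_le_ncard (fun y hy => hω.2.2 (Nat.le_succ t) hy)
        ((hfin x).subset fun y hy => hω.2.1 (t + 1) hy)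
    · filter_upwards [hT.ae_regular] with ω hω t ht
      obtain ⟨⟨hx, -⟩, y, hy1, hy2⟩ := ht
      rw [hx] at hy1 hy2
      exact Set.ncard_lt_ncard ⟨fun y hy => hω.2.2 (Nat.le_succ t) hy, fun h => hy2 (h hy1)⟩
        ((hfin x).subset fun y hy => hω.2.1 (t + 1) hy)
  rw [← ENNReal.div_eq_inv_mul, ENNReal.le_div_iff_mul_le (Or.inl hε') (by simp), mul_comm,
    ← ENNReal.tsum_mul_left]
  exact (ENNReal.tsum_le_tsum h1).trans h2

/-! ### The interacting walk -/

namespace IsExtendedSRW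

variable (hY : IsExtendedSRW Gbar o r μ 𝓕 G Y) (hg : IsTouchGrowth Gbar G0 μ 𝓕 G Y)
include hY hg

/-- Off the boundary the conditional law of the step is that of simple random walk; as V is
countable, it suffices to integrate the conditional probabilities of single sites over A. -/
lemma setLIntegral_succ [Countable V] [IsProbabilityMeasure μ]
    (hfin : ∀ x, (Gbar.neighborSet x).Finite) (t : ℕ) {A : Set Ω} (hA : MeasurableSet[𝓕 t] A)
    (hAb : ∀ x, Disjoint A (boundaryVisit Gbar G Y t x)) (f : V → ℝ≥0∞) :
    ∫⁻ ω in A, f (Y (t + 1) ω) ∂μ = ∫⁻ ω in A, stepMean Gbar f (Y t ω) ∂μ := by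
  have hYm : ∀ t, Measurable (Y t) := fun t => (hg.adapted_walk t).mono (𝓕.le t) le_rfl
  have hA' := 𝓕.le t _ hA
  have hv : ∀ y, MeasurableSet {ω | Y (t + 1) ω = y} := fun y =>
    𝓕.le _ _ (hg.measurableSet_visit (t + 1) y)
  have hpt : ∀ y, μ (A ∩ {ω | Y (t + 1) ω = y}) = ∫⁻ ω in A, srwStep Gbar (Y t ω) {y} ∂μ := by
    intro y
    have hi : Integrable ({ω | Y (t + 1) ω = y}.indicator fun _ => (1 : ℝ)) μ :=
      (integrable_const 1).indicator (hv y)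
    have e1 := setIntegral_condExp (𝓕.le t) hi hA
    rw [setIntegral_indicator (hv y)] at e1
    have e2 : ∫ ω in A, (μ[{ω | Y (t + 1) ω = y}.indicator fun _ => (1 : ℝ) | 𝓕 t]) ω ∂μ =
        ∫ ω in A, (srwStep Gbar (Y t ω)).real {y} ∂μ := by
      refine setIntegral_congr_ae hA' ?_
      filter_upwards [hY.step t y, hg.ae_mem_boundary_iff hfin] with ω h1 h2 h3
      refine h1 fun h => ?_
      exact Set.disjoint_left.mp (hAb _) h3 ((h2 t).mp h)
    have hmeas : Measurable fun ω => (srwStep Gbar (Y t ω)).real {y} :=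
      (Measurable.of_discrete (f := fun x => (srwStep Gbar x).real {y})).comp (hYm t)
    have e3 : ∫⁻ ω in A, srwStep Gbar (Y t ω) {y} ∂μ =
        ENNReal.ofReal (∫ ω in A, (srwStep Gbar (Y t ω)).real {y} ∂μ) := by
      rw [ofReal_integral_eq_lintegral_ofReal]
      · simp
      · refine Integrable.of_bound hmeas.aestronglyMeasurable 1 (ae_of_all _ fun ω => ?_)
        rw [Real.norm_of_nonneg measureReal_nonneg]
        exact measureReal_le_one
      · exact ae_of_all _ fun ω => measureReal_nonneg
    rw [e3, ← e2, e1]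
    simp
  have hleft : ∀ ω, f (Y (t + 1) ω) = ∑' y, f y * {ω | Y (t + 1) ω = y}.indicator 1 ω := by
    intro ω
    rw [tsum_eq_single (Y (t + 1) ω)]
    · simp
    · intro y hy
      simp [hy.symm]
  have hright : ∀ ω, stepMean Gbar f (Y t ω) = ∑' y, f y * srwStep Gbar (Y t ω) {y} :=
    fun ω => lintegral_countable' f
  simp_rw [hleft, hright]
  have hm1 : ∀ y, Measurable fun ω => srwStep Gbar (Y t ω) {y} := fun y =>
    (Measurable.of_discrete (f := fun x => srwStep Gbar x {y})).comp (hYm t)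
  rw [lintegral_tsum fun y => ((measurable_one.indicator (hv y)).const_mul _).aemeasurable,
    lintegral_tsum fun y => ((hm1 y).const_mul _).aemeasurable]
  refine tsum_congr fun y => ?_
  rw [lintegral_const_mul _ (measurable_one.indicator (hv y)), lintegral_const_mul _ (hm1 y),
    ← hpt, lintegral_indicator_one (hv y), Measure.restrict_apply (hv y), Set.inter_comm]

/-- Drift inequality: off the boundary f decreases in mean and loses δ more at o; at a boundary site
only the supremum over the jump ball is available. -/
lemma lintegral_step_le [Countable V] [IsProbabilityMeasure μ]
    (hfin : ∀ x, (Gbar.neighborSet x).Finite) (hG0 : G0 ≤ Gbar)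
    (ho : ∀ y, Gbar.Adj o y → G0.Adj o y) {f : V → ℝ≥0∞} {δ : ℝ≥0∞}
    (hf : ∀ y, stepMean Gbar f y + Set.indicator {o} (fun _ => δ) y ≤ f y) (t : ℕ) :
    ∫⁻ ω, f (Y (t + 1) ω) ∂μ + δ * μ {ω | Y t ω = o} ≤ ∫⁻ ω, f (Y t ω) ∂μ +
      ∑' x, (⨆ y ∈ ball Gbar x (r x), f y) * μ (boundaryVisit Gbar G Y t x) := by
  have hYm : ∀ t, Measurable (Y t) := fun t => (hg.adapted_walk t).mono (𝓕.le t) le_rfl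
  have hfm : ∀ f : V → ℝ≥0∞, ∀ t, Measurable fun ω => f (Y t ω) := fun f t =>
    (Measurable.of_discrete (f := f)).comp (hYm t)
  set B : Set Ω := ⋃ x, boundaryVisit Gbar G Y t x with hB
  have hBm : MeasurableSet[𝓕 t] B :=
    MeasurableSet.iUnion fun x => hg.measurableSet_boundaryVisit t x
  have hBm' := 𝓕.le t _ hBm
  have hon : o ∉ boundary Gbar G0 := by
    rw [mem_boundary_iff hG0 (hfin o)]
    rintro ⟨y, h1, h2⟩
    exact h2 (ho y h1)
  have hvm : MeasurableSet {ω | Y t ω = o} := 𝓕.le t _ (hg.measurableSet_visit t o)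
  -- The site o is never in the boundary, so every visit to it pays the loss δ.
  have e1 : μ {ω | Y t ω = o} = μ (Bᶜ ∩ {ω | Y t ω = o}) := by
    rw [← measure_inter_add_sdiff _ hBm', Set.sdiff_eq, Set.inter_comm _ Bᶜ]
    rw [measure_mono_null _ (hg.measure_boundaryVisit_eq_zero hfin hG0 t hon), zero_add]
    rintro ω ⟨h1, h2⟩
    obtain ⟨x, hx⟩ := Set.mem_iUnion.mp h2
    have hxo : x = o := hx.1.symm.trans h1
    exact hxo ▸ hx
  have e2 : ∫⁻ ω in Bᶜ, f (Y (t + 1) ω) ∂μ + δ * μ {ω | Y t ω = o} ≤ ∫⁻ ω, f (Y t ω) ∂μ := by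
    rw [hY.setLIntegral_succ hg hfin t hBm.compl
      (fun x => (disjoint_compl_left).mono_right (Set.subset_iUnion _ x)), e1]
    have : δ * μ (Bᶜ ∩ {ω | Y t ω = o}) =
        ∫⁻ ω in Bᶜ, Set.indicator {o} (fun _ => δ) (Y t ω) ∂μ := by
      have : (fun ω => Set.indicator {o} (fun _ => δ) (Y t ω)) =
          {ω | Y t ω = o}.indicator fun _ => δ := by
        ext ω
        by_cases h : Y t ω = o <;> simp [h]
      rw [this, lintegral_indicator_const hvm, Measure.restrict_apply hvm, Set.inter_comm]
    rw [this, ← lintegral_add_left (hfm _ t)]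
    exact (lintegral_mono fun ω => hf (Y t ω)).trans (setLIntegral_le_lintegral _ _)
  have e3 : ∫⁻ ω in B, f (Y (t + 1) ω) ∂μ ≤
      ∑' x, (⨆ y ∈ ball Gbar x (r x), f y) * μ (boundaryVisit Gbar G Y t x) := by
    refine (lintegral_iUnion_le _ _).trans (ENNReal.tsum_le_tsum fun x => ?_)
    rw [← setLIntegral_const]
    refine setLIntegral_mono_ae' (𝓕.le t _ (hg.measurableSet_boundaryVisit t x)) ?_
    filter_upwards [hY.jump t, hg.ae_mem_boundary_iff hfin] with ω h1 h2 h3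
    have hx : Y t ω = x := h3.1
    have h4 := h1 ((h2 t).mpr (hx ▸ h3))
    rw [hx] at h4
    exact le_iSup₂ (f := fun y (_ : y ∈ ball Gbar x (r x)) => f y) _ h4
  rw [← lintegral_add_compl _ hBm']
  calc _ = ∫⁻ ω in B, f (Y (t + 1) ω) ∂μ +
        (∫⁻ ω in Bᶜ, f (Y (t + 1) ω) ∂μ + δ * μ {ω | Y t ω = o}) := by ring
    _ ≤ _ := add_le_add e3 e2
    _ = _ := add_comm _ _

/-- Lévy's Borel–Cantelli: y is visited infinitely often exactly when the conditional probabilities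
of stepping to y have infinite sum, and each non-boundary visit to x contributes the same positive
amount. -/
lemma infinite_visits_of_adj [Countable V] [IsProbabilityMeasure μ]
    (hfin : ∀ x, (Gbar.neighborSet x).Finite) {x y : V} (hxy : Gbar.Adj x y)
    (hbv : ∑' t, μ (boundaryVisit Gbar G Y t x) ≠ ∞) :
    ∀ᵐ ω ∂μ, {t | Y t ω = x}.Infinite → {t | Y t ω = y}.Infinite := by
  have hp : 0 < (srwStep Gbar x).real {y} := by
    rw [measureReal_def]
    exact ENNReal.toReal_pos (srwStep_singleton_pos (hfin x) hxy).ne' (measure_ne_top _ _)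
  have hlevy := ae_mem_limsup_atTop_iff (ℱ := 𝓕) μ (s := fun t => {ω | Y t ω = y})
    (fun t => hg.measurableSet_visit t y)
  have hnn : ∀ t, ∀ᵐ ω ∂μ, 0 ≤ (μ[{ω | Y (t + 1) ω = y}.indicator (1 : Ω → ℝ) | 𝓕 t]) ω :=
    fun t => condExp_nonneg (ae_of_all _ fun ω => Set.indicator_nonneg (by simp) ω)
  filter_upwards [hlevy, ae_all_iff.mpr hnn, ae_finite_setOfPred_mem hbv,
    ae_all_iff.mpr fun t => hY.step t y, hg.ae_mem_boundary_iff hfin] with ω h1 h2 h3 h4 h5 hinf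
  rw [mem_limsup_iff_frequently_mem, Nat.frequently_atTop_iff_infinite] at h1
  refine h1.mpr ?_
  rw [← not_summable_iff_tendsto_nat_atTop_of_nonneg h2]
  intro hs
  have hev := hs.tendsto_atTop_zero.eventually (gt_mem_nhds hp)
  have hfr : ∃ᶠ t in atTop, Y t ω = x ∧ ω ∉ boundaryVisit Gbar G Y t x := by
    rw [Nat.frequently_atTop_iff_infinite]
    exact hinf.sdiff h3
  obtain ⟨t, ⟨ht1, ht2⟩, ht3⟩ := (hfr.and_eventually hev).exists
  have h6 := h4 t fun h => ht2 (by simpa [ht1] using (h5 t).mp h)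
  rw [ht1] at h6
  exact absurd h6 (ne_of_lt ht3)

/-- An extended simple random walk whose expected number of visits to each site while the site is
in the boundary is uniformly bounded is transient. -/
theorem almostSurelyTransient [IsProbabilityMeasure μ] (hconn : Gbar.Connected)
    (hfin : ∀ x, (Gbar.neighborSet x).Finite) (htr : SRWTransient Gbar o) (hG0 : G0 ≤ Gbar)
    (ho : ∀ y, Gbar.Adj o y → G0.Adj o y) (hS : Sstar Gbar G0 o r < ∞) {K : ℝ≥0∞} (hK : K ≠ ∞)
    (hbv : ∀ x, ∑' t, μ (boundaryVisit Gbar G Y t x) ≤ K) : AlmostSurelyTransient μ Y := by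
  have := countable_of_connected hconn hfin
  set h := hitProb Gbar o with hh
  set δ : ℝ≥0∞ := 1 - stepMean Gbar h o with hδ
  have hlt := stepMean_hitProb_self_lt_one hconn hfin htr
  have hδ0 : δ ≠ 0 := (tsub_pos_of_lt hlt).ne'
  have hsup : ∀ y, stepMean Gbar h y + Set.indicator {o} (fun _ => δ) y ≤ h y := by
    intro y
    by_cases hy : y = o
    · subst hy
      simp [hh, hδ, add_tsub_cancel_of_le hlt.le]
    · simp [hy, hh, ← hitProb_of_ne hy]
  have hsum := tsum_le_of_step fun t => hY.lintegral_step_le hg hfin hG0 ho hsup t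
  rw [ENNReal.tsum_mul_left, ENNReal.tsum_comm] at hsum
  simp_rw [ENNReal.tsum_mul_left] at hsum
  have hb : ∑' x, (⨆ y ∈ ball Gbar x (r x), h y) * ∑' t, μ (boundaryVisit Gbar G Y t x) ≤
      Sstar Gbar G0 o r * K := by
    rw [Sstar, tsum_subtype (boundary Gbar G0)
      (fun x => ⨆ y ∈ ball Gbar x (r x), hitProb Gbar o y), ← ENNReal.tsum_mul_right]
    refine ENNReal.tsum_le_tsum fun x => ?_
    by_cases hx : x ∈ boundary Gbar G0
    · rw [Set.indicator_of_mem hx]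
      gcongr
      exact hbv x
    · simp [hg.measure_boundaryVisit_eq_zero hfin hG0 _ hx]
  have h0 : ∫⁻ ω, h (Y 0 ω) ∂μ ≤ 1 :=
    (lintegral_mono fun ω => hitProb_le_one _).trans (by simp)
  have hvis : ∑' t, μ {ω | Y t ω = o} ≠ ∞ := by
    intro htop
    rw [htop, ENNReal.mul_top hδ0] at hsum
    have := (hsum.trans (add_le_add h0 hb)).trans_lt
      (ENNReal.add_lt_top.mpr ⟨ENNReal.one_lt_top, ENNReal.mul_lt_top hS hK.lt_top⟩)
    exact lt_irrefl _ this
  have hofin : ∀ᵐ ω ∂μ, ¬ {t | Y t ω = o}.Infinite := by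
    filter_upwards [ae_finite_setOfPred_mem hvis] with ω hω
    exact Set.not_infinite.mpr hω
  refine ae_all_iff.mpr fun x => ?_
  -- Finiteness of visits is carried backwards along a walk, from its end o to an arbitrary x.
  have key : ∀ {x z : V} (_ : Gbar.Walk x z), (∀ᵐ ω ∂μ, ¬ {t | Y t ω = z}.Infinite) →
      ∀ᵐ ω ∂μ, ¬ {t | Y t ω = x}.Infinite := by
    intro x z p hz
    induction p with
    | nil => exact hz
    | @cons a b c hab _ ih =>
      filter_upwards [ih hz, hY.infinite_visits_of_adj hg hfin hab
        (ne_top_of_le_ne_top hK (hbv a))] with ω h1 h2 h3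
      exact h1 (h2 h3)
  obtain ⟨p⟩ := hconn.preconnected x o
  filter_upwards [key p hofin] with ω hω
  exact Set.not_infinite.mp hω

end IsExtendedSRW

end Growth

/-! ### Superharmonic functions and the power estimate -/

section Superharmonic

/-- A criterion for transience: a finite superharmonic function that is strictly superharmonic
at `o`. -/
lemma srwTransient_of_superharmonic {V : Type*} [MeasurableSpace V] [DiscreteMeasurableSpace V]
    {G : SimpleGraph V} {o : V} {f : V → ℝ≥0∞} (hf : ∀ y, stepMean G f y ≤ f y) (hfo : f o ≠ ∞)
    (ho : stepMean G f o < f o) : SRWTransient G o := by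
  set δ := f o - stepMean G f o with hδ
  have hδ0 : δ ≠ 0 := (tsub_pos_of_lt ho).ne'
  have hfm : ∀ f : V → ℝ≥0∞, ∀ n, Measurable fun w : ℕ → V => f (w n) := fun f n =>
    (Measurable.of_discrete (f := f)).comp (measurable_pi_apply n)
  have hsup : ∀ y, stepMean G f y + Set.indicator {o} (fun _ => δ) y ≤ f y := by
    intro y
    by_cases hy : y = o
    · subst hy
      simp [hδ, add_tsub_cancel_of_le ho.le]
    · simpa [hy] using hf y
  have hstep : ∀ n, ∫⁻ w, f (w (n + 1)) ∂(srwLaw G o) + δ * srwLaw G o {w | w n = o} ≤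
      ∫⁻ w, f (w n) ∂(srwLaw G o) + 0 := by
    intro n
    have h1 := srwLaw_lintegral_succ (G := G) o n MeasurableSet.univ f
    simp only [Set.mem_univ, Set.ofPred_true, Measure.restrict_univ] at h1
    have h2 : δ * srwLaw G o {w | w n = o} =
        ∫⁻ w, Set.indicator {o} (fun _ => δ) (w n) ∂(srwLaw G o) := by
      have : (fun w : ℕ → V => Set.indicator {o} (fun _ => δ) (w n)) =
          {w | w n = o}.indicator fun _ => δ := by
        ext w
        by_cases h : w n = o <;> simp [h]
      rw [this, lintegral_indicator_const (measurableSet_visit o n)]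
    rw [h1, h2, ← lintegral_add_left (hfm _ n), add_zero]
    exact lintegral_mono fun w => hsup (w n)
  have hsum := tsum_le_of_step hstep
  have h0 : ∫⁻ w, f (w 0) ∂(srwLaw G o) = f o := by
    rw [lintegral_congr_ae (g := fun _ => f o)]
    · simp
    · filter_upwards [srwLaw_start (G := G) o] with w hw
      rw [hw]
  rw [ENNReal.tsum_mul_left, h0, tsum_zero, add_zero] at hsum
  refine ae_finite_setOfPred_mem (s := fun n => {w : ℕ → V | w n = o}) fun htop => ?_
  rw [htop, ENNReal.mul_top hδ0, top_le_iff] at hsum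
  exact hfo hsum

lemma nonpos_of_hasDerivAt_nonpos {f f' : ℝ → ℝ} {b : ℝ} (h0 : f 0 ≤ 0)
    (hf : ∀ t ∈ Set.Icc 0 b, HasDerivAt f (f' t) t) (hf' : ∀ t ∈ Set.Icc 0 b, f' t ≤ 0) :
    ∀ t ∈ Set.Icc 0 b, f t ≤ 0 := by
  intro t ht
  have hanti : AntitoneOn f (Set.Icc 0 b) := by
    refine antitoneOn_of_deriv_nonpos (convex_Icc 0 b)
      (fun x hx => (hf x hx).continuousAt.continuousWithinAt)
      (fun x hx => (hf x (interior_subset hx)).differentiableAt.differentiableWithinAt)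
      fun x hx => ?_
    rw [(hf x (interior_subset hx)).deriv]
    exact hf' x (interior_subset hx)
  exact (hanti ⟨le_rfl, ht.1.trans ht.2⟩ ht ht.1).trans h0

lemma hasDerivAt_one_add_rpow (p : ℝ) {t : ℝ} (ht : t ∈ Set.Icc (0 : ℝ) (1 / 2)) :
    HasDerivAt (fun t : ℝ => (1 + t) ^ p) (p * (1 + t) ^ (p - 1)) t := by
  have := ((hasDerivAt_id t).const_add 1).rpow_const (p := p) (Or.inl (by
    have := ht.1; simp only [id]; linarith))
  simpa using this

lemma hasDerivAt_one_sub_rpow (p : ℝ) {t : ℝ} (ht : t ∈ Set.Icc (0 : ℝ) (1 / 2)) :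
    HasDerivAt (fun t : ℝ => (1 - t) ^ p) (-(p * (1 - t) ^ (p - 1))) t := by
  have := ((hasDerivAt_id t).const_sub 1).rpow_const (p := p) (Or.inl (by
    have := ht.2; simp only [id]; linarith))
  simpa using this

/-- Fourth order expansion of a symmetrized negative power. -/
lemma exists_rpow_add_rpow_le {s : ℝ} (hs : 0 < s) : ∃ C > 0, ∀ t : ℝ, |t| ≤ 1 / 2 →
    (1 + t) ^ (-s) + (1 - t) ^ (-s) ≤ 2 + s * (s + 1) * t ^ 2 + C * t ^ 4 := by
  set A := s * (s + 1) * (s + 2) * (s + 3) with hA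
  have hA0 : 0 < A := by positivity
  -- On [0, 1/2] the fourth derivative of the left side is at most A * (1 + (1/2)^(-s-4)), and that
  -- of C t⁴ is 24 C. Below, `h4` to `h0` bound the derivatives of the difference of orders 4 to 0;
  -- those of orders 3 to 0 vanish at 0.
  set C := A * (1 + (1 / 2 : ℝ) ^ (-s - 4)) / 24 with hC
  have hC0 : 0 < C := by positivity
  have h4 : ∀ t ∈ Set.Icc (0 : ℝ) (1 / 2),
      A * ((1 + t) ^ (-s - 4) + (1 - t) ^ (-s - 4)) - 24 * C ≤ 0 := by
    intro t ht
    have e1 : (1 + t) ^ (-s - 4) ≤ 1 :=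
      Real.rpow_le_one_of_one_le_of_nonpos (by linarith [ht.1]) (by linarith)
    have e2 : (1 - t) ^ (-s - 4) ≤ (1 / 2 : ℝ) ^ (-s - 4) :=
      Real.rpow_le_rpow_of_nonpos (by norm_num) (by linarith [ht.2]) (by linarith)
    have : A * ((1 + t) ^ (-s - 4) + (1 - t) ^ (-s - 4)) ≤ A * (1 + (1 / 2 : ℝ) ^ (-s - 4)) :=
      mul_le_mul_of_nonneg_left (add_le_add e1 e2) hA0.le
    rw [hC]; linarith
  have h3 : ∀ t ∈ Set.Icc (0 : ℝ) (1 / 2),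
      s * (s + 1) * (s + 2) * (-(1 + t) ^ (-s - 3) + (1 - t) ^ (-s - 3)) - 24 * C * t ≤ 0 := by
    refine nonpos_of_hasDerivAt_nonpos (by simp) (fun t ht => ?_) h4
    have := ((((hasDerivAt_one_add_rpow (-s - 3) ht).neg).add
      (hasDerivAt_one_sub_rpow (-s - 3) ht)).const_mul (s * (s + 1) * (s + 2))).sub
      ((hasDerivAt_id t).const_mul (24 * C))
    refine this.congr_deriv ?_
    rw [show -s - 3 - 1 = -s - 4 by ring]; ring
  have h2 : ∀ t ∈ Set.Icc (0 : ℝ) (1 / 2),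
      s * (s + 1) * ((1 + t) ^ (-s - 2) + (1 - t) ^ (-s - 2)) - 2 * (s * (s + 1))
        - 12 * C * t ^ 2 ≤ 0 := by
    refine nonpos_of_hasDerivAt_nonpos (by simp; linarith) (fun t ht => ?_) h3
    have := ((((hasDerivAt_one_add_rpow (-s - 2) ht).add
      (hasDerivAt_one_sub_rpow (-s - 2) ht)).const_mul (s * (s + 1))).sub_const
        (2 * (s * (s + 1)))).sub ((hasDerivAt_pow 2 t).const_mul (12 * C))
    refine this.congr_deriv ?_
    rw [show -s - 2 - 1 = -s - 3 by ring]; push_cast; ring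
  have h1 : ∀ t ∈ Set.Icc (0 : ℝ) (1 / 2),
      s * (-(1 + t) ^ (-s - 1) + (1 - t) ^ (-s - 1)) - 2 * (s * (s + 1)) * t
        - 4 * C * t ^ 3 ≤ 0 := by
    refine nonpos_of_hasDerivAt_nonpos (by simp) (fun t ht => ?_) h2
    have := (((((hasDerivAt_one_add_rpow (-s - 1) ht).neg).add
      (hasDerivAt_one_sub_rpow (-s - 1) ht)).const_mul s).sub
        ((hasDerivAt_id t).const_mul (2 * (s * (s + 1))))).sub
        ((hasDerivAt_pow 3 t).const_mul (4 * C))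
    refine this.congr_deriv ?_
    rw [show -s - 1 - 1 = -s - 2 by ring]; push_cast; ring
  have h0 : ∀ t ∈ Set.Icc (0 : ℝ) (1 / 2),
      (1 + t) ^ (-s) + (1 - t) ^ (-s) - 2 - s * (s + 1) * t ^ 2 - C * t ^ 4 ≤ 0 := by
    refine nonpos_of_hasDerivAt_nonpos (by norm_num) (fun t ht => ?_) h1
    have := ((((hasDerivAt_one_add_rpow (-s) ht).add
      (hasDerivAt_one_sub_rpow (-s) ht)).sub_const 2).sub
        ((hasDerivAt_pow 2 t).const_mul (s * (s + 1)))).sub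
        ((hasDerivAt_pow 4 t).const_mul C)
    refine this.congr_deriv ?_
    push_cast; ring
  refine ⟨C, hC0, fun t ht => ?_⟩
  rcases le_total 0 t with h | h
  · have := h0 t ⟨h, (abs_le.mp ht).2⟩
    linarith
  · have := h0 (-t) ⟨by linarith, by linarith [(abs_le.mp ht).1]⟩
    rw [show (1 : ℝ) - -t = 1 + t by ring, show (1 : ℝ) + -t = 1 - t by ring, neg_sq,
      show (-t) ^ 4 = t ^ 4 by ring] at this
    linarith

/-- The function `x ↦ (|x|² + a) ^ (-(d - 2) / 2)` is superharmonic on `ℤ^d` for large `a`. -/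
lemma exists_sum_rpow_le {d : ℕ} (hd : 3 ≤ d) : ∃ a : ℝ, 3 ≤ a ∧ ∀ x : Fin d → ℝ,
    ∑ i, ((∑ j, x j ^ 2 + a + 1 + 2 * x i) ^ (-(((d : ℝ) - 2) / 2)) +
      (∑ j, x j ^ 2 + a + 1 - 2 * x i) ^ (-(((d : ℝ) - 2) / 2))) ≤
      2 * d * (∑ j, x j ^ 2 + a) ^ (-(((d : ℝ) - 2) / 2)) := by
  have hd' : (3 : ℝ) ≤ d := by exact_mod_cast hd
  set s : ℝ := ((d : ℝ) - 2) / 2 with hs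
  have hs0 : 0 < s := by rw [hs]; linarith
  obtain ⟨C, hC, hexp⟩ := exists_rpow_add_rpow_le hs0
  have hds : 0 < d * s := by positivity
  -- The 3 gives 4|x i| ≤ x i ^ 2 + 4 ≤ v, so the expansion applies at 2 x i / v; the other term
  -- absorbs the fourth order error.
  refine ⟨3 + 8 * C / (d * s), by linarith [show 0 < 8 * C / (d * s) by positivity], fun x => ?_⟩
  set a := 3 + 8 * C / (d * s) with ha
  have ha3 : 3 ≤ a := by rw [ha]; linarith [show 0 < 8 * C / (d * s) by positivity]
  have haC : 8 * C ≤ d * s * a := by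
    rw [ha, mul_add, mul_div_cancel₀ _ hds.ne']; linarith
  set q := ∑ j, x j ^ 2 with hq
  have hq0 : 0 ≤ q := Finset.sum_nonneg fun j _ => sq_nonneg _
  set v := q + a + 1 with hv
  have hv0 : 0 < v := by rw [hv]; linarith
  have hxq : ∀ i, x i ^ 2 ≤ q := fun i =>
    Finset.single_le_sum (f := fun j => x j ^ 2) (fun j _ => sq_nonneg _) (Finset.mem_univ i)
  have hterm : ∀ i, (v + 2 * x i) ^ (-s) + (v - 2 * x i) ^ (-s) ≤
      v ^ (-s) * (2 + 4 * s * (s + 1) / v ^ 2 * x i ^ 2 + 16 * C * q / v ^ 4 * x i ^ 2) := by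
    intro i
    have hτ : |2 * x i / v| ≤ 1 / 2 := by
      rw [abs_div, abs_of_pos hv0, div_le_iff₀ hv0, abs_le]
      constructor <;> nlinarith [hxq i, sq_nonneg (x i - 2), sq_nonneg (x i + 2)]
    have hb := abs_le.mp hτ
    have e1 : v + 2 * x i = v * (1 + 2 * x i / v) := by field_simp
    have e2 : v - 2 * x i = v * (1 - 2 * x i / v) := by field_simp
    rw [e1, e2, Real.mul_rpow hv0.le (by linarith), Real.mul_rpow hv0.le (by linarith), ← mul_add]
    refine mul_le_mul_of_nonneg_left ((hexp _ hτ).trans ?_) (Real.rpow_nonneg hv0.le _)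
    have e3 : s * (s + 1) * (2 * x i / v) ^ 2 = 4 * s * (s + 1) / v ^ 2 * x i ^ 2 := by
      field_simp; ring
    have e4 : C * (2 * x i / v) ^ 4 = 16 * C * (x i ^ 2) / v ^ 4 * x i ^ 2 := by
      field_simp; ring
    rw [e3, e4]
    gcongr
    exact hxq i
  have hbern : v ^ (-s) * (1 + s / v) ≤ (q + a) ^ (-s) := by
    have hw : 0 < 1 - 1 / v := by
      rw [sub_pos, div_lt_one hv0]; linarith
    have e1 : q + a = v * (1 - 1 / v) := by field_simp; rw [hv]; ring
    rw [e1, Real.mul_rpow hv0.le hw.le]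
    refine mul_le_mul_of_nonneg_left ?_ (Real.rpow_nonneg hv0.le _)
    rw [Real.rpow_def_of_pos hw]
    have hlog := Real.log_le_sub_one_of_pos hw
    have : s / v ≤ Real.log (1 - 1 / v) * -s := by
      have : s / v = (1 - 1 / v - 1) * -s := by ring
      rw [this]
      nlinarith
    linarith [Real.add_one_le_exp (Real.log (1 - 1 / v) * -s)]
  calc _ ≤ ∑ i, v ^ (-s) *
        (2 + 4 * s * (s + 1) / v ^ 2 * x i ^ 2 + 16 * C * q / v ^ 4 * x i ^ 2) :=
        Finset.sum_le_sum fun i _ => hterm i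
    _ = v ^ (-s) * (2 * d + 4 * s * (s + 1) / v ^ 2 * q + 16 * C * q / v ^ 4 * q) := by
        rw [← Finset.mul_sum, Finset.sum_add_distrib, Finset.sum_add_distrib, ← Finset.mul_sum,
          ← Finset.mul_sum, ← hq]
        simp [mul_comm]
    _ ≤ v ^ (-s) * (2 * d * (1 + s / v)) := by
        refine mul_le_mul_of_nonneg_left ?_ (Real.rpow_nonneg hv0.le _)
        -- Here s + 1 = d / 2 is what matters: the second order term 2 d s q / v² falls short of the
        -- Bernoulli gain 2 d s / v by 2 d s (a + 1) / v², which covers the error 16 C / v².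
        have hs1 : 4 * s * (s + 1) = 2 * d * s := by rw [hs]; ring
        have hqv : q ≤ v := by linarith
        have e1 : 16 * C * q / v ^ 4 * q ≤ 16 * C / v ^ 2 := by
          rw [div_mul_eq_mul_div, div_le_div_iff₀ (by positivity) (by positivity)]
          have : q * q ≤ v * v := mul_self_le_mul_self hq0 hqv
          nlinarith [mul_le_mul_of_nonneg_left this (show 0 ≤ 16 * C * v ^ 2 by positivity)]
        have e2 : 2 * d * s / v ^ 2 * q + 16 * C / v ^ 2 ≤ 2 * d * s / v := by
          rw [div_mul_eq_mul_div, ← add_div, div_le_div_iff₀ (by positivity) hv0]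
          have : 2 * d * s * q + 16 * C ≤ 2 * d * s * v := by
            rw [hv]; nlinarith
          nlinarith
        rw [hs1]
        have e3 : 2 * (d : ℝ) * (1 + s / v) = 2 * d + 2 * d * s / v := by ring
        rw [e3]
        linarith
    _ = 2 * d * (v ^ (-s) * (1 + s / v)) := by ring
    _ ≤ _ := mul_le_mul_of_nonneg_left hbern (by positivity)

end Superharmonic

/-! ### The integer lattice -/

section Lattice

variable {d : ℕ}

/-- The `2 d` unit steps of the nearest-neighbour walk on `ℤ^d`. -/
def latticeStep (p : Fin d × Bool) : Fin d → ℤ := Pi.single p.1 (if p.2 then 1 else -1)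

lemma latticeStep_injective : Function.Injective (latticeStep (d := d)) := by
  rintro ⟨i, b⟩ ⟨j, c⟩ h
  have hi := congrFun h i
  simp only [latticeStep, Pi.single_eq_same] at hi
  by_cases hij : i = j
  · subst hij
    cases b <;> cases c <;> simp_all
  · rw [Pi.single_eq_of_ne hij] at hi
    cases b <;> simp at hi

/-- The `ℓ¹` distance on `ℤ^d`. -/
def l1Dist (x y : Fin d → ℤ) : ℕ := ∑ i, (x i - y i).natAbs

lemma l1Dist_triangle (x y z : Fin d → ℤ) : l1Dist x z ≤ l1Dist x y + l1Dist y z := by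
  unfold l1Dist
  rw [← Finset.sum_add_distrib]
  exact Finset.sum_le_sum fun i _ => by omega

lemma latticeGraph_adj_iff {x y : Fin d → ℤ} : (latticeGraph d).Adj x y ↔ l1Dist x y = 1 := by
  change ∑ i, |x i - y i| = 1 ↔ _
  rw [l1Dist, ← Nat.cast_inj (R := ℤ)]
  push_cast
  rfl

lemma l1Dist_add_latticeStep (x : Fin d → ℤ) (p : Fin d × Bool) :
    l1Dist x (x + latticeStep p) = 1 := by
  rw [l1Dist, Finset.sum_eq_single p.1]
  · rcases p with ⟨i, b⟩
    cases b <;> simp [latticeStep]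
  · intro j _ hj
    simp [latticeStep, Pi.single_eq_of_ne hj]
  · simp

/-- A unit step brings any site closer to any other one. -/
lemma exists_latticeStep_l1Dist_lt {x y : Fin d → ℤ} (hxy : x ≠ y) :
    ∃ p, l1Dist (x + latticeStep p) y + 1 = l1Dist x y := by
  obtain ⟨i, hi⟩ := Function.ne_iff.mp hxy
  refine ⟨(i, decide (x i < y i)), ?_⟩
  rw [l1Dist, l1Dist, ← Finset.add_sum_erase _ _ (Finset.mem_univ i),
    ← Finset.add_sum_erase _ (fun j => (x j - y j).natAbs) (Finset.mem_univ i)]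
  have h1 : ∑ j ∈ Finset.univ.erase i,
      ((x + latticeStep (i, decide (x i < y i))) j - y j).natAbs =
      ∑ j ∈ Finset.univ.erase i, (x j - y j).natAbs := by
    refine Finset.sum_congr rfl fun j hj => ?_
    simp [latticeStep, Pi.single_eq_of_ne (Finset.ne_of_mem_erase hj)]
  rw [h1]
  have h2 : ((x + latticeStep (i, decide (x i < y i))) i - y i).natAbs + 1 =
      (x i - y i).natAbs := by
    by_cases h : x i < y i
    · simp [latticeStep, h]; omega
    · simp [latticeStep, h]; omega
  omega

lemma exists_walk_length_eq_l1Dist (x y : Fin d → ℤ) :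
    ∃ p : (latticeGraph d).Walk x y, p.length = l1Dist x y := by
  induction h : l1Dist x y generalizing x with
  | zero =>
    have hxy : x = y := by
      by_contra hne
      obtain ⟨p, hp⟩ := exists_latticeStep_l1Dist_lt hne
      omega
    subst hxy
    exact ⟨SimpleGraph.Walk.nil, rfl⟩
  | succ n ih =>
    have hne : x ≠ y := by
      rintro rfl
      simp [l1Dist] at h
    obtain ⟨p, hp⟩ := exists_latticeStep_l1Dist_lt hne
    obtain ⟨q, hq⟩ := ih (x + latticeStep p) (by omega)
    exact ⟨SimpleGraph.Walk.cons (latticeGraph_adj_iff.mpr (l1Dist_add_latticeStep x p)) q,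
      by simp [hq]⟩

lemma latticeGraph_connected : (latticeGraph d).Connected :=
  ⟨fun x y => ⟨(exists_walk_length_eq_l1Dist x y).choose⟩⟩

lemma latticeGraph_dist (x y : Fin d → ℤ) : (latticeGraph d).dist x y = l1Dist x y := by
  refine le_antisymm ?_ ?_
  · obtain ⟨p, hp⟩ := exists_walk_length_eq_l1Dist x y
    exact hp ▸ SimpleGraph.dist_le p
  · obtain ⟨p, hp⟩ := latticeGraph_connected.exists_walk_length_eq_dist x y
    rw [← hp]
    clear hp
    induction p with
    | nil => simp [l1Dist]
    | @cons a b c hab _ ih =>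
      have h1 := latticeGraph_adj_iff.mp hab
      have h2 := l1Dist_triangle a b c
      rw [SimpleGraph.Walk.length_cons]
      omega

lemma latticeGraph_neighborSet (x : Fin d → ℤ) :
    (latticeGraph d).neighborSet x =
      ((Finset.univ.image fun p => x + latticeStep p : Finset (Fin d → ℤ)) :
        Set (Fin d → ℤ)) := by
  ext y
  simp only [SimpleGraph.mem_neighborSet, Finset.coe_image, Finset.coe_univ,
    Set.image_univ, Set.mem_range]
  constructor
  · intro h
    have h1 := latticeGraph_adj_iff.mp h
    obtain ⟨p, hp⟩ := exists_latticeStep_l1Dist_lt h.ne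
    refine ⟨p, ?_⟩
    by_contra hne
    obtain ⟨p', hp'⟩ := exists_latticeStep_l1Dist_lt hne
    omega
  · rintro ⟨p, rfl⟩
    exact latticeGraph_adj_iff.mpr (l1Dist_add_latticeStep x p)

lemma latticeGraph_neighborSet_finite (x : Fin d → ℤ) :
    ((latticeGraph d).neighborSet x).Finite := by
  rw [latticeGraph_neighborSet]
  exact Finset.finite_toSet _

lemma latticeGraph_ncard_neighborSet (x : Fin d → ℤ) :
    ((latticeGraph d).neighborSet x).ncard = 2 * d := by
  rw [latticeGraph_neighborSet, Set.ncard_coe_finset,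
    Finset.card_image_of_injective _ fun _ _ h => latticeStep_injective (add_left_cancel h)]
  simp [mul_comm]

lemma lintegral_uniformOn_finset {α : Type*} [MeasurableSpace α] [MeasurableSingletonClass α]
    (s : Finset α) (f : α → ℝ≥0∞) :
    ∫⁻ x, f x ∂(uniformOn (s : Set α)) = (s.card : ℝ≥0∞)⁻¹ * ∑ x ∈ s, f x := by
  rw [uniformOn, ProbabilityTheory.cond, lintegral_smul_measure, lintegral_finset]
  simp

lemma stepMean_latticeGraph (hd : 0 < d) (f : (Fin d → ℤ) → ℝ≥0∞) (x : Fin d → ℤ) :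
    stepMean (latticeGraph d) f x =
      (2 * d : ℝ≥0∞)⁻¹ * ∑ p : Fin d × Bool, f (x + latticeStep p) := by
  have hne : ((latticeGraph d).neighborSet x).Nonempty :=
    ⟨x + latticeStep (⟨0, hd⟩, true), latticeGraph_adj_iff.mpr (l1Dist_add_latticeStep _ _)⟩
  rw [stepMean, srwStep, if_pos ⟨latticeGraph_neighborSet_finite x, hne⟩,
    latticeGraph_neighborSet, lintegral_uniformOn_finset,
    Finset.sum_image fun _ _ _ _ h => latticeStep_injective (add_left_cancel h),
    Finset.card_image_of_injective _ fun _ _ h => latticeStep_injective (add_left_cancel h)]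
  simp [mul_comm]

/-- The squared Euclidean norm of a lattice site. -/
def sqNorm (x : Fin d → ℤ) : ℝ := ∑ i, (x i : ℝ) ^ 2

lemma sqNorm_nonneg (x : Fin d → ℤ) : 0 ≤ sqNorm x := Finset.sum_nonneg fun _ _ => sq_nonneg _

lemma sqNorm_add_latticeStep (x : Fin d → ℤ) (p : Fin d × Bool) :
    sqNorm (x + latticeStep p) = sqNorm x + 1 + (if p.2 then 2 * (x p.1 : ℝ) else -(2 * x p.1)) := by
  have h : ∀ i, ((x + latticeStep p) i : ℝ) ^ 2 = (x i : ℝ) ^ 2 +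
      Pi.single (M := fun _ => ℝ) p.1 (1 + (if p.2 then 2 * (x p.1 : ℝ) else -(2 * x p.1))) i := by
    intro i
    rcases p with ⟨j, b⟩
    by_cases hij : i = j
    · subst hij
      cases b <;> simp [latticeStep] <;> ring
    · simp [latticeStep, Pi.single_eq_of_ne hij]
  unfold sqNorm
  rw [Finset.sum_congr rfl fun i _ => h i, Finset.sum_add_distrib, Finset.sum_pi_single']
  simp [add_assoc]

/-- A superharmonic comparison function on the lattice, with its value at the origin normalized. -/
def latticePotential (a : ℝ) (x : Fin d → ℤ) : ℝ≥0∞ :=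
  ENNReal.ofReal (((sqNorm x + a) / a) ^ (-(((d : ℝ) - 2) / 2)))

/-- Pairing the two opposite steps in each coordinate turns the mean into the sum of
`exists_sum_rpow_le`; normalizing at the origin is a constant factor. -/
lemma exists_stepMean_latticePotential_le (hd : 3 ≤ d) : ∃ a : ℝ, 3 ≤ a ∧
    ∀ x : Fin d → ℤ, stepMean (latticeGraph d) (latticePotential a) x ≤ latticePotential a x := by
  obtain ⟨a, ha, h⟩ := exists_sum_rpow_le hd
  refine ⟨a, ha, fun x => ?_⟩
  have ha0 : 0 < a := by linarith
  set s := ((d : ℝ) - 2) / 2 with hs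
  have hd0 : (0 : ℝ) < 2 * d := by
    have : (3 : ℝ) ≤ d := by exact_mod_cast hd
    linarith
  have hnn : ∀ y : Fin d → ℤ, 0 ≤ ((sqNorm y + a) / a) ^ (-s) := fun y =>
    Real.rpow_nonneg (div_nonneg (add_nonneg (sqNorm_nonneg y) ha0.le) ha0.le) _
  have hc : (2 * d : ℝ≥0∞) = ENNReal.ofReal (2 * d) := by
    rw [ENNReal.ofReal_mul (by norm_num)]; simp
  rw [stepMean_latticeGraph (by omega), hc, ← ENNReal.ofReal_inv_of_pos hd0]
  simp only [latticePotential, ← hs]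
  rw [← ENNReal.ofReal_sum_of_nonneg fun p _ => hnn _, ← ENNReal.ofReal_mul (by positivity)]
  refine ENNReal.ofReal_le_ofReal ?_
  rw [inv_mul_le_iff₀ hd0]
  have hdiv : ∀ y : Fin d → ℤ, ((sqNorm y + a) / a) ^ (-s) =
      (sqNorm y + a) ^ (-s) * (a ^ (-s))⁻¹ := fun y => by
    rw [Real.div_rpow (add_nonneg (sqNorm_nonneg y) ha0.le) ha0.le, div_eq_mul_inv]
  simp_rw [hdiv]
  rw [← Finset.sum_mul, ← mul_assoc]
  refine mul_le_mul_of_nonneg_right ?_ (inv_nonneg.mpr (Real.rpow_nonneg ha0.le _))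
  rw [Fintype.sum_prod_type]
  refine le_trans (le_of_eq (Finset.sum_congr rfl fun i _ => ?_)) (h fun i => (x i : ℝ))
  rw [Fintype.sum_bool, sqNorm_add_latticeStep, sqNorm_add_latticeStep]
  have e1 : sqNorm x + 1 + (if true = true then 2 * (x i : ℝ) else -(2 * x i)) + a =
      ∑ j, (x j : ℝ) ^ 2 + a + 1 + 2 * x i := by
    simp only [if_true, sqNorm]; ring
  have e2 : sqNorm x + 1 + (if false = true then 2 * (x i : ℝ) else -(2 * x i)) + a =
      ∑ j, (x j : ℝ) ^ 2 + a + 1 - 2 * x i := by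
    simp [sqNorm]; ring
  rw [e1, e2]

lemma latticePotential_zero {a : ℝ} (ha : 0 < a) :
    latticePotential a (0 : Fin d → ℤ) = 1 := by
  simp [latticePotential, sqNorm, ha.ne']

/-- All neighbours of 0 have squared norm 1, where the potential is below its value 1 at 0: strict
superharmonicity. -/
lemma latticeGraph_srwTransient (hd : 3 ≤ d) : SRWTransient (latticeGraph d) 0 := by
  obtain ⟨a, ha, h⟩ := exists_stepMean_latticePotential_le hd
  have ha0 : 0 < a := by linarith
  have hd' : (3 : ℝ) ≤ d := by exact_mod_cast hd
  refine srwTransient_of_superharmonic h (by simp [latticePotential_zero ha0]) ?_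
  rw [latticePotential_zero ha0, stepMean_latticeGraph (by omega)]
  have hlt : ENNReal.ofReal (((1 + a) / a) ^ (-(((d : ℝ) - 2) / 2))) < 1 := by
    rw [ENNReal.ofReal_lt_one]
    refine Real.rpow_lt_one_of_one_lt_of_neg ?_ (by linarith)
    rw [lt_div_iff₀ ha0]; linarith
  have hval : ∀ p : Fin d × Bool, latticePotential a (0 + latticeStep p) =
      ENNReal.ofReal (((1 + a) / a) ^ (-(((d : ℝ) - 2) / 2))) := by
    intro p
    rw [latticePotential, sqNorm_add_latticeStep]
    simp [sqNorm]
  simp_rw [hval]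
  rw [Finset.sum_const, nsmul_eq_mul, ← mul_assoc]
  have hc : ((Finset.univ : Finset (Fin d × Bool)).card : ℝ≥0∞) = 2 * d := by
    simp [mul_comm]
  have hd0 : (d : ℝ≥0∞) ≠ 0 := by
    simp; omega
  rw [hc, ENNReal.inv_mul_cancel (by simp [hd0]) (ENNReal.mul_ne_top (by simp) (by simp)), one_mul]
  exact hlt

/-- Twice the supremum norm of a lattice site, i.e. the side length of the box around the origin
that has the site on its boundary. -/
def boxSide (x : Fin d → ℤ) : ℕ := 2 * Finset.univ.sup fun i => (x i).natAbs

lemma mem_boxBoundary_boxSide (hd : 0 < d) (x : Fin d → ℤ) : x ∈ boxBoundary d (boxSide x) := by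
  have : Nonempty (Fin d) := ⟨⟨0, hd⟩⟩
  refine ⟨fun i => ?_, ?_⟩
  · have := Finset.le_sup (f := fun i => (x i).natAbs) (Finset.mem_univ i)
    simp only [boxSide]
    rw [Int.abs_eq_natAbs]
    omega
  · obtain ⟨i, _, hi⟩ := Finset.exists_mem_eq_sup Finset.univ Finset.univ_nonempty
      fun i => (x i).natAbs
    refine ⟨i, ?_⟩
    rw [boxSide, hi, Int.abs_eq_natAbs]
    push_cast
    rfl

lemma boxSide_le_two_mul_l1Dist (x : Fin d → ℤ) : boxSide x ≤ 2 * l1Dist x 0 := by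
  refine Nat.mul_le_mul_left 2 (Finset.sup_le fun i _ => ?_)
  have := Finset.single_le_sum (f := fun i => (x i - (0 : Fin d → ℤ) i).natAbs)
    (fun _ _ => Nat.zero_le _) (Finset.mem_univ i)
  simpa [l1Dist] using this

lemma boxSide_pos {x : Fin d → ℤ} (hx : x ≠ 0) : 0 < boxSide x := by
  obtain ⟨i, hi⟩ := Function.ne_iff.mp hx
  have := Finset.le_sup (f := fun i => (x i).natAbs) (Finset.mem_univ i)
  simp only [boxSide]
  simp only [Pi.zero_apply] at hi
  omega

lemma boxBoundary_finite (k : ℕ) : (boxBoundary d k).Finite := by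
  refine (Set.finite_Icc (fun _ : Fin d => -(k : ℤ)) fun _ => (k : ℤ)).subset fun x hx => ?_
  constructor <;> intro i <;> have := hx.1 i <;> have := abs_le.mp (le_refl |x i|) <;>
    dsimp only <;> omega

lemma l1Dist_sq_le (x : Fin d → ℤ) : (l1Dist x 0 : ℝ) ^ 2 ≤ d * sqNorm x := by
  have h1 : (l1Dist x 0 : ℝ) = ∑ i, |(x i : ℝ)| := by
    simp [l1Dist, Nat.cast_natAbs]
  rw [h1, sqNorm]
  have := sq_sum_le_card_mul_sum_sq (s := (Finset.univ : Finset (Fin d)))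
    (f := fun i => |(x i : ℝ)|)
  simpa using this

/-- As c < 1, the ball around x stays at ℓ¹ distance at least ρ|x| - 1 from 0, and there the
potential is of order |x|^(2-d). -/
lemma exists_hitProb_lattice_le (hd : 3 ≤ d) {r : (Fin d → ℤ) → ℝ}
    (hr : IsJumpRadius (latticeGraph d) 0 r) : ∃ C : ℝ, 0 ≤ C ∧ ∀ x ≠ 0,
    ∀ y ∈ ball (latticeGraph d) x (r x),
      hitProb (latticeGraph d) 0 y ≤ ENNReal.ofReal (C * (boxSide x : ℝ) ^ (2 - (d : ℤ))) := by
  obtain ⟨a, ha, h⟩ := exists_stepMean_latticePotential_le hd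
  obtain ⟨c, hc, hr⟩ := hr
  have ha0 : 0 < a := by linarith
  have hd' : (3 : ℝ) ≤ d := by exact_mod_cast hd
  set s := ((d : ℝ) - 2) / 2 with hs
  -- Since c may be negative, it is replaced by `max c 0`; this gives ρ ≤ 1, needed when the radius
  -- bound is 1.
  set ρ := 1 - max c 0 with hρ
  have hρ0 : 0 < ρ := by rw [hρ, sub_pos]; exact max_lt hc one_pos
  have hρ1 : ρ ≤ 1 := by rw [hρ]; linarith [le_max_right c 0]
  -- Inverse of the constant in (1 + q)² ≤ (2 + 2da) (|y|² + a) / a, where q is the ℓ¹ norm of y.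
  set m := (2 + 2 * d * a)⁻¹ with hm
  have hm0 : 0 < m := by rw [hm]; positivity
  refine ⟨(m * ρ ^ 2 / 4) ^ (-s), by positivity, fun x hx y hy => ?_⟩
  refine (hitProb_le_of_superharmonic (latticePotential_zero ha0).ge h y).trans ?_
  refine ENNReal.ofReal_le_ofReal ?_
  have hk : (0 : ℝ) < boxSide x := by exact_mod_cast boxSide_pos hx
  have hkpow : (boxSide x : ℝ) ^ (2 - (d : ℤ)) = ((boxSide x : ℝ) ^ 2) ^ (-s) := by
    rw [← Real.rpow_natCast, ← Real.rpow_mul hk.le, ← Real.rpow_intCast]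
    congr 1
    rw [hs]; push_cast; ring
  rw [hkpow, ← Real.mul_rpow (by positivity) (by positivity)]
  refine Real.rpow_le_rpow_of_nonpos (by positivity) ?_ (by linarith)
  have hdist : ((latticeGraph d).dist x y : ℝ) ≤ r x := hy
  have hrx := (hr x).2
  rw [latticeGraph_dist] at hdist hrx
  have htri : (l1Dist x 0 : ℝ) ≤ l1Dist x y + l1Dist y 0 := by
    exact_mod_cast l1Dist_triangle x y 0
  have hside : (boxSide x : ℝ) ≤ 2 * l1Dist x 0 := by
    exact_mod_cast boxSide_le_two_mul_l1Dist x
  set R : ℝ := ((l1Dist x 0 : ℕ) : ℝ) with hR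
  set q : ℝ := ((l1Dist y 0 : ℕ) : ℝ) with hq
  have hq0 : 0 ≤ q := by positivity
  have hR0 : 0 < R := by linarith
  have hfar : ρ * R ≤ 1 + q := by
    rcases max_cases 1 (c * R) with ⟨h1, _⟩ | ⟨h1, _⟩
    · nlinarith
    · have : c * R ≤ max c 0 * R := mul_le_mul_of_nonneg_right (le_max_left _ _) hR0.le
      rw [hρ]; linarith
  have hsq : q ^ 2 ≤ d * sqNorm y := l1Dist_sq_le y
  have hn := sqNorm_nonneg y
  have h1 : ρ ^ 2 * (boxSide x : ℝ) ^ 2 / 4 ≤ (1 + q) ^ 2 := by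
    have : ρ * boxSide x / 2 ≤ 1 + q := by nlinarith
    have h2 := pow_le_pow_left₀ (by positivity) this 2
    calc _ = (ρ * boxSide x / 2) ^ 2 := by ring
      _ ≤ _ := h2
  have h2 : (1 + q) ^ 2 ≤ (2 + 2 * d * a) * ((sqNorm y + a) / a) := by
    rw [mul_div_assoc', le_div_iff₀ ha0]
    have : (1 + q) ^ 2 ≤ 2 + 2 * (d * sqNorm y) := by nlinarith [sq_nonneg (1 - q)]
    have h3 : (1 + q) ^ 2 * a ≤ (2 + 2 * (d * sqNorm y)) * a := by gcongr
    have h4 : 0 ≤ (d : ℝ) * a * a := by positivity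
    nlinarith
  calc m * ρ ^ 2 / 4 * (boxSide x : ℝ) ^ 2 = m * (ρ ^ 2 * (boxSide x : ℝ) ^ 2 / 4) := by ring
    _ ≤ m * ((2 + 2 * d * a) * ((sqNorm y + a) / a)) := by gcongr; exact h1.trans h2
    _ = (sqNorm y + a) / a := by
      rw [← mul_assoc, hm, inv_mul_cancel₀ (by positivity), one_mul]

/-- Boundary sites are grouped by the box they lie on; within a group the hitting bound is constant,
so each group costs at most N(k) k^(2-d) up to a factor. -/
lemma latticeGraph_Sstar_lt_top (hd : 3 ≤ d) {D0 : SimpleGraph (Fin d → ℤ)}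
    {r : (Fin d → ℤ) → ℝ} (hD0 : D0 ≤ latticeGraph d)
    (ho : ∀ y, (latticeGraph d).Adj 0 y → D0.Adj 0 y) (hr : IsJumpRadius (latticeGraph d) 0 r)
    (hsum : Summable fun k : ℕ =>
      (boxCount d D0 (k + 1) : ℝ) * ((k + 1 : ℕ) : ℝ) ^ (2 - (d : ℤ))) :
    Sstar (latticeGraph d) D0 0 r < ∞ := by
  obtain ⟨C, hC, hle⟩ := exists_hitProb_lattice_le hd hr
  set S := boundary (latticeGraph d) D0 with hS
  have h0 : (0 : Fin d → ℤ) ∉ S := by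
    rw [hS, mem_boundary_iff hD0 (latticeGraph_neighborSet_finite 0)]
    rintro ⟨y, h1, h2⟩
    exact h2 (ho y h1)
  set g : ℕ → ℝ≥0∞ := fun k => ENNReal.ofReal (C * (k : ℝ) ^ (2 - (d : ℤ))) with hg
  have h1 : Sstar (latticeGraph d) D0 0 r ≤ ∑' x : S, g (boxSide (x : Fin d → ℤ)) := by
    refine ENNReal.tsum_le_tsum fun x => iSup₂_le fun y hy => hle x ?_ y hy
    intro hx
    exact h0 (hx ▸ x.2)
  -- The hypothesis sums from k = 1; the term k = 0 drops out because 0 to a nonzero integer power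
  -- is 0, even for a negative exponent.
  have hz : g 0 = 0 := by
    have : (2 - (d : ℤ)) ≠ 0 := by omega
    simp [hg, zero_zpow _ this]
  have h2 : ∑' x : S, g (boxSide (x : Fin d → ℤ)) ≤
      ∑' k : ℕ, ENNReal.ofReal
        (C * ((boxCount d D0 (k + 1) : ℝ) * ((k + 1 : ℕ) : ℝ) ^ (2 - (d : ℤ)))) := by
    rw [← ENNReal.tsum_fiberwise _ fun x : S => boxSide (x : Fin d → ℤ)]
    have h3 : ∀ k, ∑' x : (fun x : S => boxSide (x : Fin d → ℤ)) ⁻¹' {k},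
        g (boxSide ((x : S) : Fin d → ℤ)) ≤ (boxCount d D0 k : ℝ≥0∞) * g k := by
      intro k
      have hfin : (S ∩ boxBoundary d k).Finite := (boxBoundary_finite k).inter_of_right _
      have e1 : ∀ x : (fun x : S => boxSide (x : Fin d → ℤ)) ⁻¹' {k},
          g (boxSide ((x : S) : Fin d → ℤ)) = g k := fun x => by
        have : boxSide ((x : S) : Fin d → ℤ) = k := x.2
        rw [this]
      simp_rw [e1]
      rw [ENNReal.tsum_set_const]
      gcongr
      rw [boxCount, ← hS]
      have e2 : ((fun x : S => boxSide (x : Fin d → ℤ)) ⁻¹' {k}).encard ≤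
          (S ∩ boxBoundary d k).encard := by
        rw [← Subtype.val_injective.encard_image]
        refine Set.encard_le_encard ?_
        rintro _ ⟨x, hx, rfl⟩
        have hx' : boxSide (x : Fin d → ℤ) = k := hx
        exact ⟨x.2, hx' ▸ mem_boxBoundary_boxSide (by omega) _⟩
      rw [← hfin.cast_ncard_eq] at e2
      exact_mod_cast ENat.toENNReal_le.mpr e2
    refine (ENNReal.tsum_le_tsum h3).trans ?_
    rw [tsum_eq_zero_add' ENNReal.summable, hz, mul_zero, zero_add]
    refine ENNReal.tsum_le_tsum fun k => le_of_eq ?_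
    rw [hg, ← ENNReal.ofReal_natCast (boxCount d D0 (k + 1)), ← ENNReal.ofReal_mul (by positivity)]
    congr 1
    ring
  exact (h1.trans h2).trans_lt (hsum.mul_left C).tsum_ofReal_lt_top

end Lattice

end GrowingWalk

end

open GrowingWalk
theorem proposition1p6 :
    -- general graphs
    (∀ (V : Type*) [MeasurableSpace V] [DiscreteMeasurableSpace V]
      (Gbar G0 : SimpleGraph V) (o : V) (r : V → ℝ),
      Gbar.Connected → (∀ x, (Gbar.neighborSet x).Finite) → SRWTransient Gbar o →
      G0 ≤ Gbar → (∀ y, Gbar.Adj o y → G0.Adj o y) →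
      IsJumpRadius Gbar o r → Sstar Gbar G0 o r < ∞ →
      ∀ (Ω : Type*) [mΩ : MeasurableSpace Ω] (μ : Measure Ω) [IsProbabilityMeasure μ]
        (𝓕 : Filtration ℕ mΩ) (G : ℕ → Ω → SimpleGraph V) (Y : ℕ → Ω → V),
        IsExtendedSRW Gbar o r μ 𝓕 G Y →
        (IsOBT Gbar G0 μ 𝓕 G Y → AlmostSurelyTransient μ Y) ∧
        ((∃ D : ℕ, ∀ x, (Gbar.neighborSet x).ncard ≤ D) →
          IsPOBT Gbar G0 μ 𝓕 G Y → AlmostSurelyTransient μ Y)) ∧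
    -- the integer lattice
    (∀ (d : ℕ), 3 ≤ d →
      ∀ (D0 : SimpleGraph (Fin d → ℤ)) (r : (Fin d → ℤ) → ℝ),
      D0 ≤ latticeGraph d → (∀ y, (latticeGraph d).Adj 0 y → D0.Adj 0 y) →
      IsJumpRadius (latticeGraph d) 0 r →
      Summable (fun k : ℕ =>
        (boxCount d D0 (k + 1) : ℝ) * ((k + 1 : ℕ) : ℝ) ^ (2 - (d : ℤ))) →
      ∀ (Ω : Type*) [mΩ : MeasurableSpace Ω] (μ : Measure Ω) [IsProbabilityMeasure μ]
        (𝓕 : Filtration ℕ mΩ) (G : ℕ → Ω → SimpleGraph (Fin d → ℤ))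
        (Y : ℕ → Ω → (Fin d → ℤ)),
        IsExtendedSRW (latticeGraph d) 0 r μ 𝓕 G Y →
        IsPOBT (latticeGraph d) D0 μ 𝓕 G Y → AlmostSurelyTransient μ Y) := by
  refine ⟨?_, ?_⟩
  · intro V _ _ Gbar G0 o r hconn hfin htr hG0 ho _ hS Ω _ μ _ 𝓕 G Y hY
    have := countable_of_connected hconn hfin
    refine ⟨fun hg => ?_, fun ⟨D, hD⟩ hg => ?_⟩
    · exact hY.almostSurelyTransient hg.toIsTouchGrowth hconn hfin htr hG0 ho hS
        ENNReal.one_ne_top fun x => hg.tsum_boundaryVisit_le hfin x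
    · obtain ⟨K, hK, hbv⟩ := hg.exists_tsum_boundaryVisit_le hfin hD
      exact hY.almostSurelyTransient hg.toIsTouchGrowth hconn hfin htr hG0 ho hS hK hbv
  · intro d hd D0 r hD0 ho hr hsum Ω _ μ _ 𝓕 G Y hY hg
    obtain ⟨K, hK, hbv⟩ := hg.exists_tsum_boundaryVisit_le latticeGraph_neighborSet_finite
      fun x => (latticeGraph_ncard_neighborSet x).le
    exact hY.almostSurelyTransient hg.toIsTouchGrowth latticeGraph_connected
      latticeGraph_neighborSet_finite (latticeGraph_srwTransient hd) hD0 ho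
      (latticeGraph_Sstar_lt_top hd hD0 ho hr hsum) hK hbv
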